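/- Let $0\le k\le n-1$, and let $s_1,\dots,s_{n-1}$ be the simple reflections of $S_n$, with length function $\ell$. Let $\mathcal H$ be the Hecke algebra of $S_n$ over $\mathbb Q(v)$, generated by $T_1,\dots,T_{n-1}$ with the braid relations and $(T_i-v)(T_i+v^{-1})=0$. It has the basis $T_w$, $w\in S_n$, where $T_w$ is the product of the $T_i$ along a reduced word of $w$. The bar involution of $\mathcal H$ is the ring automorphism with $\overline v=v^{-1}$ and $\overline{T_i}=T_i^{-1}$. The Kazhdan–Lusztig element $C_w$ is the unique element with $\overline{C_w}=C_w$ and $C_w-T_w\in\bigoplus_y v\mathbb Z[v]\,T_y$. Let $J=\{1,\dots,n-1\}\setminus\{k\}$, let $W_J=\langle s_j: j\in J\rangle$ with longest element $w_0^J$, let $W^J$ be the set of minimal length representatives of the cosets $wW_J$, and put $C_J=C_{w_0^J}$. Let $M^J$ be the $\mathcal H$-module induced from the one-dimensional representation $T_jm_1=-v^{-1}m_1$ $(j\in J)$ of $\mathcal H(W_J)$, with basis $m_y=T_ym_1$ $(y\in W^J)$ and bar involution $\overline{hm_1}=\overline h\,m_1$. For $y\in W^J$ let $C^J_y\in M^J$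 be the unique element with $\overline{C^J_y}=C^J_y$ and $C^J_y-m_y\in\bigoplus_{z\in W^J}v\mathbb Z[v]\,m_z$. For a Young diagram $\lambda$ inside the rectangle with $k$ rows and $n-k$ columns, put $r_{ij}=\max(r_{i,j+1},r_{i+1,j})+1$ for $(i,j)\in\lambda$ and $r_{ij}=0$ for $(i,j)\notin\lambda$, put $[r]=(v^r-v^{-r})/(v-v^{-1})$, and set $$w_\lambda=\prod_{(i,j)\in\lambda}s_{k+j-i},\qquad X_\lambda=\prod_{(i,j)\in\lambda}\Bigl(T_{k+j-i}-\frac{v^{r_{ij}}}{[r_{ij}]}\Bigr),$$ where $(i,j)$ is the box in row $i$ and column $j$, and the factors are written from left to right in the order that takes the rows from the last to the first and each row from right to left. **Proposition.** Let $\lambda$ be the full rectangle with $k$ rows and $n-k$ columns, and let $w_0$ be the longest element of $S_n$. Then $w_\lambda\in W^J$, the elements $C^J_{w_\lambda}$, $C_J$ and $C_{w_0}$ exist and are unique, and $$X_\lambda\, m_1=C^J_{w_\lambda}\ \text{ in } M^J .$$ Moreover $w_\lambda w_0^J=w_0$ and $$X_\lambda\, C_J=C_{w_0}\ \text{ in }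 \mathcal H .$$ -/

import Mathlib

noncomputable section

namespace HeckeGrass

open scoped Polynomial

/-! ### The symmetric group `S_n` and its simple reflections -/

/-- The index set `{1, …, n-1}` of the simple reflections of `S_n`. -/
abbrev Idx (n : ℕ) : Type := {a : ℕ // 1 ≤ a ∧ a < n}

/-- The simple reflection `s_a` exchanges the `a`-th and the `(a+1)`-st of the `n` letters; the
`a`-th letter is the element of value `a - 1` of `Fin n`. -/
def simple {n : ℕ} (a : Idx n) : Equiv.Perm (Fin n) :=
  Equiv.swap ⟨a.1 - 1, by have := a.2; omega⟩ ⟨a.1, a.2.2⟩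

/-- The permutation `s_{a_1} ⋯ s_{a_l}` spelled by a word. -/
def wordPerm {n : ℕ} (l : List (Idx n)) : Equiv.Perm (Fin n) := (l.map simple).prod

theorem exists_word {n : ℕ} (w : Equiv.Perm (Fin n)) : ∃ l : List (Idx n), wordPerm l = w := by
  rcases n with _ | n
  · exact ⟨[], Subsingleton.elim _ _⟩
  · have hw : w ∈ Submonoid.closure
        (Set.range fun i : Fin n ↦ Equiv.swap i.castSucc i.succ) := by
      rw [Equiv.Perm.mclosure_swap_castSucc_succ]; trivial
    induction hw using Submonoid.closure_induction with
    | mem x hx =>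
      obtain ⟨i, rfl⟩ := hx
      refine ⟨[⟨i.1 + 1, by omega, by omega⟩], ?_⟩
      simp only [wordPerm, simple, List.map_cons, List.map_nil, List.prod_cons, List.prod_nil,
        mul_one]
      congr 1
    | one => exact ⟨[], rfl⟩
    | mul x y _ _ hx hy =>
      obtain ⟨l, rfl⟩ := hx
      obtain ⟨m, rfl⟩ := hy
      exact ⟨l ++ m, by simp [wordPerm]⟩

/-- The length of a permutation: the least length of a word in the simple reflections for it. -/
def len {n : ℕ} (w : Equiv.Perm (Fin n)) : ℕ :=
  sInf {m | ∃ l : List (Idx n), l.length = m ∧ wordPerm l = w}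

theorem exists_reduced {n : ℕ} (w : Equiv.Perm (Fin n)) :
    ∃ l : List (Idx n), l.length = len w ∧ wordPerm l = w := by
  have h : {m | ∃ l : List (Idx n), l.length = m ∧ wordPerm l = w}.Nonempty := by
    obtain ⟨l, hl⟩ := exists_word w
    exact ⟨l.length, l, rfl, hl⟩
  exact Nat.sInf_mem h

/-- A reduced word for `w`. -/
def reducedWord {n : ℕ} (w : Equiv.Perm (Fin n)) : List (Idx n) := (exists_reduced w).choose

/-- The parabolic subgroup `W_J`. -/
def parabolic {n : ℕ} (J : Set (Idx n)) : Subgroup (Equiv.Perm (Fin n)) :=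
  Subgroup.closure (simple '' J)

/-- The set `W^J` of minimal length representatives of the cosets `w W_J`. -/
def minReps {n : ℕ} (J : Set (Idx n)) : Set (Equiv.Perm (Fin n)) :=
  {w | ∀ u ∈ parabolic J, len w ≤ len (w * u)}

/-- `w` is an element of maximal length of the subgroup `W`. -/
def IsLongest {n : ℕ} (W : Subgroup (Equiv.Perm (Fin n))) (w : Equiv.Perm (Fin n)) : Prop :=
  w ∈ W ∧ ∀ u ∈ W, len u ≤ len w

/-- `J = {1, …, n-1} \ {k}`, so that `W_J = S_k × S_{n-k}`. -/
def maxJ (n k : ℕ) : Set (Idx n) := {a | a.1 ≠ k}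

/-! ### The ground field `ℚ(v)` -/

/-- The field `ℚ(v)`. -/
abbrev Qv : Type := RatFunc ℚ

/-- The variable `v`. -/
def v : Qv := RatFunc.X

theorem v_ne_zero : v ≠ 0 := RatFunc.X_ne_zero

/-- The quantum integer `[r] = (v^r - v^{-r}) / (v - v^{-1})`. -/
def qInt (r : ℕ) : Qv := (v ^ r - v⁻¹ ^ r) / (v - v⁻¹)

/-- The elements of `v ℤ[v]`. -/
def InVZv (c : Qv) : Prop := ∃ p : ℤ[X], c = v * Polynomial.aeval v p

theorem eval_v_inv_injective :
    Function.Injective (Polynomial.eval₂RingHom (RatFunc.C (K := ℚ)) v⁻¹) := by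
  let _ : Algebra ℚ Qv := RatFunc.instAlgebraOfPolynomial ℚ ℚ
  have h : @Transcendental ℚ Qv _ _ (RatFunc.instAlgebraOfPolynomial ℚ ℚ) (v⁻¹ : Qv) := by
    intro h
    have h' := h.inv
    rw [inv_inv] at h'
    exact RatFunc.transcendental_X h'
  have h2 := transcendental_iff_injective.mp h
  intro p q hpq
  exact h2 hpq

/-- The automorphism `v ↦ v⁻¹` of `ℚ(v)`. -/
def barQv : Qv →+* Qv :=
  RatFunc.liftRingHom (Polynomial.eval₂RingHom (RatFunc.C (K := ℚ)) v⁻¹)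
    (nonZeroDivisors_le_comap_nonZeroDivisors_of_injective _ eval_v_inv_injective)

theorem barQv_v : barQv v = v⁻¹ := by
  simp [barQv, v, RatFunc.liftRingHom_apply]

/-! ### The Hecke algebra -/

/-- The defining relations of the Hecke algebra: the quadratic relations
`(T_a - v)(T_a + v⁻¹) = 0` and the braid relations. -/
inductive HeckeRel (n : ℕ) : FreeAlgebra Qv (Idx n) → FreeAlgebra Qv (Idx n) → Prop
  | quad (a : Idx n) :
      HeckeRel n
        ((FreeAlgebra.ι Qv a - algebraMap Qv _ v) * (FreeAlgebra.ι Qv a + algebraMap Qv _ v⁻¹)) 0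
  | braid (a b : Idx n) (h : a.1 + 1 = b.1) :
      HeckeRel n
        (FreeAlgebra.ι Qv a * FreeAlgebra.ι Qv b * FreeAlgebra.ι Qv a)
        (FreeAlgebra.ι Qv b * FreeAlgebra.ι Qv a * FreeAlgebra.ι Qv b)
  | comm (a b : Idx n) (h : a.1 + 1 < b.1) :
      HeckeRel n (FreeAlgebra.ι Qv a * FreeAlgebra.ι Qv b)
        (FreeAlgebra.ι Qv b * FreeAlgebra.ι Qv a)

/-- The Hecke algebra `H` of `S_n` over `ℚ(v)`. -/
def Hecke (n : ℕ) : Type := RingQuot (HeckeRel n)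

instance (n : ℕ) : Ring (Hecke n) := inferInstanceAs (Ring (RingQuot (HeckeRel n)))

instance (n : ℕ) : Algebra Qv (Hecke n) :=
  inferInstanceAs (Algebra Qv (RingQuot (HeckeRel n)))

/-- The canonical surjection from the free algebra. -/
def heckeMk (n : ℕ) : FreeAlgebra Qv (Idx n) →ₐ[Qv] Hecke n :=
  RingQuot.mkAlgHom Qv (HeckeRel n)

/-- The generator `T_a`. -/
def T {n : ℕ} (a : Idx n) : Hecke n := heckeMk n (FreeAlgebra.ι Qv a)

/-- The constant `c ∈ ℚ(v)` as an element of `H`. -/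
abbrev cst (n : ℕ) (c : Qv) : Hecke n := algebraMap Qv (Hecke n) c

theorem heckeMk_rel {n : ℕ} {x y : FreeAlgebra Qv (Idx n)} (h : HeckeRel n x y) :
    heckeMk n x = heckeMk n y := RingQuot.mkAlgHom_rel Qv h

theorem T_quad {n : ℕ} (a : Idx n) : (T a - cst n v) * (T a + cst n v⁻¹) = 0 := by
  have h := heckeMk_rel (HeckeRel.quad a)
  simpa [T, cst] using h

theorem T_braid {n : ℕ} (a b : Idx n) (h : a.1 + 1 = b.1) : T a * T b * T a = T b * T a * T b := by
  have h := heckeMk_rel (HeckeRel.braid a b h)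
  simpa [T] using h

theorem T_comm {n : ℕ} (a b : Idx n) (h : a.1 + 1 < b.1) : T a * T b = T b * T a := by
  have h := heckeMk_rel (HeckeRel.comm a b h)
  simpa [T] using h

/-- The basis element `T_w`: the product of the generators along a reduced word of `w`. -/
def Tw {n : ℕ} (w : Equiv.Perm (Fin n)) : Hecke n := ((reducedWord w).map T).prod

/-! ### The bar involution of `H` -/

/-- The element `T_a - v + v⁻¹`, which is the inverse of `T_a`. -/
def Tinv {n : ℕ} (a : Idx n) : Hecke n := T a - cst n v + cst n v⁻¹

theorem T_mul_Tinv {n : ℕ} (a : Idx n) : T a * Tinv a = 1 := by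
  have h := T_quad a
  have hc : cst n v * T a = T a * cst n v := Algebra.commutes _ _
  have hv : cst n v * cst n v⁻¹ = 1 := by
    rw [← map_mul, mul_inv_cancel₀ v_ne_zero, map_one]
  have h2 : (T a - cst n v) * (T a + cst n v⁻¹) = T a * Tinv a - 1 := by
    rw [← hv]
    simp only [Tinv, mul_add, sub_mul, mul_sub, hc]
    abel
  rw [h] at h2
  exact (sub_eq_zero.mp h2.symm)

theorem Tinv_mul_T {n : ℕ} (a : Idx n) : Tinv a * T a = 1 := by
  have hc : Tinv a * T a = T a * Tinv a := by
    simp only [Tinv, mul_add, sub_mul, mul_sub, add_mul, Algebra.commutes (A := Hecke n)]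
  rw [hc, T_mul_Tinv]

/-- A copy of `H` on which the scalars of `ℚ(v)` act through `v ↦ v⁻¹`. -/
def HeckeBar (n : ℕ) : Type := Hecke n

instance (n : ℕ) : Ring (HeckeBar n) := inferInstanceAs (Ring (Hecke n))

instance (n : ℕ) : Algebra Qv (HeckeBar n) :=
  RingHom.toAlgebra' (R := Qv) (S := Hecke n) ((algebraMap Qv (Hecke n)).comp barQv)
    (fun c x ↦ Algebra.commutes (barQv c) x)

theorem heckeBar_algebraMap (n : ℕ) (c : Qv) :
    algebraMap Qv (HeckeBar n) c = (cst n (barQv c) : Hecke n) := rfl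

/-- The algebra map from the free algebra to the twisted copy of `H` with `T_a ↦ T_a⁻¹`. -/
def preBar (n : ℕ) : FreeAlgebra Qv (Idx n) →ₐ[Qv] HeckeBar n :=
  FreeAlgebra.lift Qv (A := HeckeBar n) Tinv

theorem preBar_ι {n : ℕ} (a : Idx n) :
    preBar n (FreeAlgebra.ι Qv a) = (Tinv a : Hecke n) :=
  FreeAlgebra.lift_ι_apply (A := HeckeBar n) _ _

theorem Tinv_braid {n : ℕ} (a b : Idx n) (h : a.1 + 1 = b.1) :
    Tinv a * Tinv b * Tinv a = Tinv b * Tinv a * Tinv b := by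
  refine left_inv_eq_right_inv (a := T a * T b * T a) ?_ ?_
  · have h1 : Tinv a * Tinv b * Tinv a * (T a * T b * T a) =
        Tinv a * (Tinv b * (Tinv a * T a) * T b) * T a := by noncomm_ring
    rw [h1]
    simp [Tinv_mul_T]
  · rw [T_braid a b h]
    have h1 : T b * T a * T b * (Tinv b * Tinv a * Tinv b) =
        T b * (T a * (T b * Tinv b) * Tinv a) * Tinv b := by noncomm_ring
    rw [h1]
    simp [T_mul_Tinv]

theorem Tinv_comm {n : ℕ} (a b : Idx n) (h : a.1 + 1 < b.1) :
    Tinv a * Tinv b = Tinv b * Tinv a := by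
  refine left_inv_eq_right_inv (a := T b * T a) ?_ ?_
  · have h1 : Tinv a * Tinv b * (T b * T a) = Tinv a * (Tinv b * T b) * T a := by noncomm_ring
    rw [h1]
    simp [Tinv_mul_T]
  · rw [← T_comm a b h]
    have h1 : T a * T b * (Tinv b * Tinv a) = T a * (T b * Tinv b) * Tinv a := by noncomm_ring
    rw [h1]
    simp [T_mul_Tinv]

theorem barQv_v_inv : barQv v⁻¹ = v := by
  rw [map_inv₀, barQv_v, inv_inv]

theorem Tinv_quad {n : ℕ} (a : Idx n) :
    (Tinv a - cst n v⁻¹) * (Tinv a + cst n v) = 0 := by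
  have h := T_quad a
  have h1 : Tinv a - cst n v⁻¹ = T a - cst n v := by unfold Tinv; abel
  have h2 : Tinv a + cst n v = T a + cst n v⁻¹ := by unfold Tinv; abel
  rw [h1, h2, h]

theorem preBar_rel (n : ℕ) {x y : FreeAlgebra Qv (Idx n)} (h : HeckeRel n x y) :
    preBar n x = preBar n y := by
  cases h with
  | quad a =>
    rw [map_mul, map_sub, map_add, map_zero, AlgHom.commutes, AlgHom.commutes,
      heckeBar_algebraMap, heckeBar_algebraMap, preBar_ι, barQv_v, barQv_v_inv]
    exact Tinv_quad a
  | braid a b h =>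
    rw [map_mul, map_mul, map_mul, map_mul, preBar_ι, preBar_ι]
    exact Tinv_braid a b h
  | comm a b h =>
    rw [map_mul, map_mul, preBar_ι, preBar_ι]
    exact Tinv_comm a b h

/-- The bar involution of `H`, as a `ℚ(v)`-algebra map to the twisted copy. -/
def barAlgHom (n : ℕ) : Hecke n →ₐ[Qv] HeckeBar n :=
  RingQuot.liftAlgHom Qv ⟨preBar n, fun _ _ h ↦ preBar_rel n h⟩

/-- The bar involution of `H`: the ring endomorphism with `v ↦ v⁻¹` and `T_a ↦ T_a⁻¹`. -/
def bar (n : ℕ) : Hecke n →+* Hecke n := (barAlgHom n).toRingHom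

theorem bar_cst (n : ℕ) (c : Qv) : bar n (cst n c) = cst n (barQv c) :=
  (barAlgHom n).commutes c

theorem bar_T {n : ℕ} (a : Idx n) : bar n (T a) = Tinv a :=
  (RingQuot.liftAlgHom_mkAlgHom_apply Qv (preBar n) (fun _ _ h ↦ preBar_rel n h) _).trans
    (preBar_ι a)

/-! ### The Kazhdan–Lusztig basis of `H` -/

/-- The conditions on the Kazhdan–Lusztig element `C_w`: it is bar invariant and
`C_w - T_w ∈ ⊕_y v ℤ[v] T_y`. -/
def IsKL {n : ℕ} (w : Equiv.Perm (Fin n)) (x : Hecke n) : Prop :=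
  bar n x = x ∧
    ∃ c : Equiv.Perm (Fin n) → Qv, (∀ y, InVZv (c y)) ∧ x - Tw w = ∑ y, c y • Tw y

/-- The Kazhdan–Lusztig element `C_w`, the unique element with `IsKL w`. -/
def C {n : ℕ} (w : Equiv.Perm (Fin n)) : Hecke n := Classical.epsilon (IsKL w)

/-! ### The induced module `M^J` and its parabolic Kazhdan–Lusztig basis -/

/-- The left ideal of `H` generated by the `T_j + v⁻¹`, `j ∈ J`. -/
def indIdeal {n : ℕ} (J : Set (Idx n)) : Submodule (Hecke n) (Hecke n) :=
  Submodule.span (Hecke n) ((fun j ↦ T j + cst n v⁻¹) '' J)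

/-- The `H`-module `M^J` induced from the one-dimensional representation `T_j m_1 = -v⁻¹ m_1`
(`j ∈ J`) of `H(W_J)`: the left `H`-module generated by `m_1` subject to these relations. -/
abbrev M {n : ℕ} (J : Set (Idx n)) : Type := Hecke n ⧸ indIdeal J

/-- The generator `m_1` of `M^J`. -/
def m1 {n : ℕ} (J : Set (Idx n)) : M J := Submodule.Quotient.mk 1

/-- The element `m_y = T_y m_1`. -/
def mb {n : ℕ} (J : Set (Idx n)) (y : Equiv.Perm (Fin n)) : M J := Tw y • m1 J

theorem indIdeal_le_comap {n : ℕ} (J : Set (Idx n)) :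
    indIdeal J ≤ (indIdeal J).comap (bar n).toSemilinearMap := by
  refine Submodule.span_le.mpr ?_
  rintro _ ⟨j, hj, rfl⟩
  have h : bar n (T j + cst n v⁻¹) = T j + cst n v⁻¹ := by
    rw [map_add, bar_T, bar_cst, barQv_v_inv, Tinv]
    abel
  change bar n (T j + cst n v⁻¹) ∈ indIdeal J
  rw [h]
  exact Submodule.subset_span ⟨j, hj, rfl⟩

/-- The bar involution of `M^J`, given by `h m_1 ↦ bar(h) m_1`. -/
def barM {n : ℕ} (J : Set (Idx n)) : M J →ₛₗ[bar n] M J :=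
  Submodule.mapQ (indIdeal J) (indIdeal J) (bar n).toSemilinearMap (indIdeal_le_comap J)

theorem barM_smul_m1 {n : ℕ} (J : Set (Idx n)) (h : Hecke n) :
    barM J (h • m1 J) = bar n h • m1 J := by
  have h1 : barM J (m1 J) = m1 J := by
    change Submodule.Quotient.mk (bar n 1) = _
    rw [map_one]
    rfl
  rw [map_smulₛₗ, h1]

open Classical in
/-- The conditions on the parabolic Kazhdan–Lusztig element `C^J_y`: it is bar invariant and
`C^J_y - m_y ∈ ⊕_{z ∈ W^J} v ℤ[v] m_z`. -/
def IsParabolicKL {n : ℕ} (J : Set (Idx n)) (y : Equiv.Perm (Fin n)) (x : M J) : Prop :=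
  barM J x = x ∧
    ∃ c : Equiv.Perm (Fin n) → Qv, (∀ z, InVZv (c z)) ∧
      x - mb J y = ∑ z with z ∈ minReps J, c z • mb J z

/-- The parabolic Kazhdan–Lusztig element `C^J_y`, the unique element with `IsParabolicKL J y`. -/
def CJ {n : ℕ} (J : Set (Idx n)) (y : Equiv.Perm (Fin n)) : M J :=
  Classical.epsilon (IsParabolicKL J y)

/-! ### Young diagrams, `w_λ` and `X_λ`

Rows and columns of a `YoungDiagram` are numbered from `0`, so that the content
`k + j - i` of a box is not affected. -/

/-- The rectangle with `a` rows and `b` columns. -/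
def rect (a b : ℕ) : YoungDiagram where
  cells := Finset.range a ×ˢ Finset.range b
  isLowerSet := by
    rintro ⟨i, j⟩ ⟨i', j'⟩ ⟨h1, h2⟩ h
    simp only [Finset.coe_product, Finset.coe_range, Set.mem_prod, Set.mem_Iio] at h h1 h2 ⊢
    omega

theorem mem_rect {a b i j : ℕ} : (i, j) ∈ rect a b ↔ i < a ∧ j < b := by
  rw [← YoungDiagram.mem_cells]
  simp [rect]

/-- The boxes of a diagram, from the lowest row to the first one and in each row from right to
left. -/
def boxes (μ : YoungDiagram) : List (ℕ × ℕ) :=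
  (List.range (μ.colLen 0)).reverse.flatMap fun i ↦
    (List.range (μ.rowLen i)).reverse.map fun j ↦ (i, j)

theorem mem_boxes {μ : YoungDiagram} {b : ℕ × ℕ} : b ∈ boxes μ ↔ b ∈ μ := by
  obtain ⟨i, j⟩ := b
  simp only [boxes, List.mem_flatMap, List.mem_reverse, List.mem_range, List.mem_map,
    Prod.mk.injEq]
  constructor
  · rintro ⟨i', _, j', hj, rfl, rfl⟩
    exact YoungDiagram.mem_iff_lt_rowLen.mpr hj
  · intro h
    exact ⟨i, (YoungDiagram.mem_iff_lt_colLen.mp h).trans_le (μ.colLen_anti 0 j (Nat.zero_le _)),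
      j, YoungDiagram.mem_iff_lt_rowLen.mp h, rfl, rfl⟩

/-- The index `k + j - i` of the box `b = (i, j)`. -/
def boxIdx {n k : ℕ} {μ : YoungDiagram} (hμ : μ ≤ rect k (n - k)) (b : {b // b ∈ boxes μ}) :
    Idx n :=
  ⟨k + b.1.2 - b.1.1, by
    have h : (b.1.1, b.1.2) ∈ rect k (n - k) := hμ (mem_boxes.mp b.2)
    rw [mem_rect] at h
    omega⟩

/-- `w_λ`, the product of the `s_{k+j-i}` over the boxes `(i, j)` of `λ`. -/
def wYoung {n k : ℕ} {μ : YoungDiagram} (hμ : μ ≤ rect k (n - k)) : Equiv.Perm (Fin n) :=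
  wordPerm ((boxes μ).attach.map (boxIdx hμ))

/-- The shift `r_{ij} = max (r_{i,j+1}, r_{i+1,j}) + 1` of a box of `λ`, and `0` outside `λ`. -/
def shift (μ : YoungDiagram) (i j : ℕ) : ℕ :=
  if h : (i, j) ∈ μ then max (shift μ i (j + 1)) (shift μ (i + 1) j) + 1 else 0
termination_by μ.colLen 0 + μ.rowLen 0 - (i + j)
decreasing_by
  all_goals
    have h1 := YoungDiagram.mem_iff_lt_rowLen.mp h
    have h2 := YoungDiagram.mem_iff_lt_colLen.mp h
    have h3 := μ.rowLen_anti 0 i (Nat.zero_le _)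
    have h4 := μ.colLen_anti 0 j (Nat.zero_le _)
    omega

/-- `X_λ`, the product of the `T_{k+j-i} - v^{r_{ij}} / [r_{ij}]` over the boxes of `λ`. -/
def X {n k : ℕ} {μ : YoungDiagram} (hμ : μ ≤ rect k (n - k)) : Hecke n :=
  ((boxes μ).attach.map fun b ↦
    T (boxIdx hμ b) -
      cst n (v ^ shift μ b.1.1 b.1.2 / qInt (shift μ b.1.1 b.1.2))).prod

end HeckeGrass

end

noncomputable section

namespace HeckeGrass

open scoped Polynomial

/-! ### Inversions and length -/

/-! For the longest element `w` of `W_J`, the Kazhdan–Lusztig element is explicit: it is the sum of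
`(-v)^(ℓ(w) - ℓ(u)) T_u` over `u ∈ W_J` (`parabolicSum`, `isKL_parabolicSum`). Up to a scalar, this
is the only element supported on `W_J` that every `T_a + v⁻¹`, `a ∈ J`, annihilates from the left
(`coeffs_of_eigen`). So `X_λ C_J = C_{w_0}` follows once every `T_a + v⁻¹` kills `X_λ C_J` and the
coefficient at `w_0` is `1`.

The annihilation comes from the Yang–Baxter relation (`yang_baxter`), which moves `T_a + v⁻¹` from
left to right through the factors of `X_λ`, changing its index. Unless `a = n - k`, it leaves the
rectangle on the right with an index different from `k`, and then it kills `C_J`. For `a = n - k` it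
meets the leftmost factor, which is `T_a - v`, and the quadratic relation gives zero
(`Z_mul_rowsProd`). The coefficient at `w_0` is a leading term, because `w_λ w_0^J = w_0` with
lengths adding and `X_λ` has `k(n-k) ≤ ℓ(w_λ)` factors.

The statement in `M^J` is read off from the one in `H` through the map `m_1 ↦ C_J` (`embed`). The
coefficient of `m_z` in `X_λ m_1` is the coefficient of `T_{z w_0^J}` in `C_{w_0}`, a power of `-v`
that is trivial only for `z = w_λ`. Bar invariance holds factor by factor.

Uniqueness is the usual triangularity argument: the bar involution fixes the leading coefficient up
to `v ↦ v⁻¹`, and no nonzero element of `v ℤ[v]` is invariant under that substitution. Coefficients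
make sense because the `T_w` form a basis: the regular representation gives independence, and `n!`
normal forms span. -/

/-- The smaller letter exchanged by `s_a`. -/
def lo {n : ℕ} (a : Idx n) : Fin n := ⟨a.1 - 1, by have := a.2; omega⟩

/-- The larger letter exchanged by `s_a`. -/
def hi {n : ℕ} (a : Idx n) : Fin n := ⟨a.1, a.2.2⟩

theorem lo_lt_hi {n : ℕ} (a : Idx n) : lo a < hi a := by
  have := a.2
  simp only [lo, hi, Fin.lt_def]
  omega

theorem simple_eq {n : ℕ} (a : Idx n) : simple a = Equiv.swap (lo a) (hi a) := rfl

@[simp] theorem simple_lo {n : ℕ} (a : Idx n) : simple a (lo a) = hi a := Equiv.swap_apply_left _ _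

@[simp] theorem simple_hi {n : ℕ} (a : Idx n) : simple a (hi a) = lo a := Equiv.swap_apply_right _ _

@[simp] theorem simple_inv {n : ℕ} (a : Idx n) : (simple a)⁻¹ = simple a := Equiv.swap_inv _ _

@[simp] theorem simple_mul_self {n : ℕ} (a : Idx n) : simple a * simple a = 1 :=
  Equiv.swap_mul_self _ _

@[simp] theorem simple_mul_cancel {n : ℕ} (a : Idx n) (w : Equiv.Perm (Fin n)) :
    simple a * (simple a * w) = w := by
  rw [← mul_assoc, simple_mul_self, one_mul]

theorem simple_lt_simple {n : ℕ} (a : Idx n) (x y : Fin n) :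
    simple a y < simple a x ↔ (y < x ∧ ¬ (y = lo a ∧ x = hi a)) ∨ (x = lo a ∧ y = hi a) := by
  have ha := a.2
  rw [simple_eq, Equiv.swap_apply_def, Equiv.swap_apply_def]
  simp only [lo, hi, Fin.ext_iff, Fin.lt_def]
  split_ifs <;> first | omega | (simp only; omega)

theorem inv_apply_apply {n : ℕ} (w : Equiv.Perm (Fin n)) (i : Fin n) : w⁻¹ (w i) = i :=
  w.symm_apply_apply i

theorem apply_inv_apply {n : ℕ} (w : Equiv.Perm (Fin n)) (i : Fin n) : w (w⁻¹ i) = i :=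
  w.apply_symm_apply i

/-- The inversions of `w`, as pairs of positions. -/
def inversions {n : ℕ} (w : Equiv.Perm (Fin n)) : Finset (Fin n × Fin n) :=
  Finset.univ.filter fun p ↦ p.1 < p.2 ∧ w p.2 < w p.1

theorem mem_inversions {n : ℕ} {w : Equiv.Perm (Fin n)} {i j : Fin n} :
    (i, j) ∈ inversions w ↔ i < j ∧ w j < w i := by
  simp [inversions]

/-- The only new inversion is the pair of positions of the two exchanged letters; adjacent values
compare alike with every other value. -/
theorem card_inversions_simple_mul {n : ℕ} {a : Idx n} {w : Equiv.Perm (Fin n)}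
    (h : w⁻¹ (lo a) < w⁻¹ (hi a)) :
    (inversions (simple a * w)).card = (inversions w).card + 1 := by
  have hnot : (w⁻¹ (lo a), w⁻¹ (hi a)) ∉ inversions w := by
    simp [mem_inversions, (lo_lt_hi a).le]
  rw [← Finset.card_insert_of_notMem hnot]
  congr 1
  ext ⟨i, j⟩
  rw [Finset.mem_insert, mem_inversions, mem_inversions, Prod.mk.injEq, Equiv.Perm.eq_inv_iff_eq,
    Equiv.Perm.eq_inv_iff_eq, Equiv.Perm.mul_apply, Equiv.Perm.mul_apply]
  by_cases hij : i < j
  · rw [simple_lt_simple a (w i) (w j)]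
    have h2 : ¬ (w j = lo a ∧ w i = hi a) := by
      rintro ⟨h1, h2⟩
      rw [← h1, ← h2, inv_apply_apply, inv_apply_apply] at h
      exact lt_asymm h hij
    tauto
  · simp only [hij, false_and, or_false, false_iff]
    rintro ⟨h1, h2⟩
    rw [← h1, ← h2, inv_apply_apply, inv_apply_apply] at h
    exact hij h

theorem card_inversions_simple_mul' {n : ℕ} {a : Idx n} {w : Equiv.Perm (Fin n)}
    (h : w⁻¹ (hi a) < w⁻¹ (lo a)) :
    (inversions (simple a * w)).card + 1 = (inversions w).card := by
  have h2 := card_inversions_simple_mul (a := a) (w := simple a * w) (by simpa using h)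
  rw [simple_mul_cancel] at h2
  exact h2.symm

theorem inv_lo_lt_or {n : ℕ} (a : Idx n) (w : Equiv.Perm (Fin n)) :
    w (lo a) < w (hi a) ∨ w (hi a) < w (lo a) :=
  lt_or_gt_of_ne (by simpa using (lo_lt_hi a).ne)

theorem wordPerm_cons {n : ℕ} (a : Idx n) (l : List (Idx n)) :
    wordPerm (a :: l) = simple a * wordPerm l := by simp [wordPerm]

theorem wordPerm_append {n : ℕ} (l m : List (Idx n)) :
    wordPerm (l ++ m) = wordPerm l * wordPerm m := by simp [wordPerm]

theorem inversions_one {n : ℕ} : inversions (1 : Equiv.Perm (Fin n)) = ∅ := by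
  ext ⟨i, j⟩
  simpa [mem_inversions] using fun h : i < j ↦ h.le

theorem card_inversions_wordPerm_le {n : ℕ} (l : List (Idx n)) :
    (inversions (wordPerm l)).card ≤ l.length := by
  induction l with
  | nil => simp [wordPerm, inversions_one]
  | cons a l ih =>
    rw [wordPerm_cons, List.length_cons]
    rcases inv_lo_lt_or a (wordPerm l)⁻¹ with h | h
    · rw [card_inversions_simple_mul h]; omega
    · have := card_inversions_simple_mul' h; omega

theorem eq_one_of_ascents {n : ℕ} (w : Equiv.Perm (Fin n)) (h : ∀ a, w (lo a) < w (hi a)) :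
    w = 1 := by
  rcases n with _ | n
  · exact Subsingleton.elim _ _
  · have hm : StrictMono w := by
      rw [Fin.strictMono_iff_lt_succ]
      intro i
      exact h ⟨i.1 + 1, by omega, by omega⟩
    let e : Fin (n + 1) ≃o Fin (n + 1) := hm.orderIsoOfSurjective w w.surjective
    have he : e = OrderIso.refl _ := Subsingleton.elim _ _
    ext i
    have := congrArg (fun f : Fin (n + 1) ≃o Fin (n + 1) ↦ f i) he
    exact congrArg Fin.val this

/-- Bubble sort: unless `w = 1`, some pair of consecutive letters is out of order, and exchanging
them costs one letter of the word and removes one inversion. -/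
theorem exists_word_card_inversions {n : ℕ} (w : Equiv.Perm (Fin n)) :
    ∃ l : List (Idx n), l.length = (inversions w).card ∧ wordPerm l = w := by
  induction hm : (inversions w).card generalizing w with
  | zero =>
    refine ⟨[], rfl, ?_⟩
    have h : w⁻¹ = 1 := by
      refine eq_one_of_ascents _ fun a ↦ ?_
      rcases inv_lo_lt_or a w⁻¹ with h | h
      · exact h
      · have := card_inversions_simple_mul' h; omega
    rw [inv_eq_one] at h
    simp [wordPerm, h]
  | succ m ih =>
    have h : ∃ a : Idx n, w⁻¹ (hi a) < w⁻¹ (lo a) := by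
      by_contra! hc
      have h : w⁻¹ = 1 := eq_one_of_ascents _ fun a ↦
        (inv_lo_lt_or a w⁻¹).resolve_right (hc a).not_gt
      rw [inv_eq_one] at h
      simp [h, inversions_one] at hm
    obtain ⟨a, ha⟩ := h
    have h2 := card_inversions_simple_mul' ha
    obtain ⟨l, hl, hw⟩ := ih (simple a * w) (by omega)
    exact ⟨a :: l, by simp [hl], by rw [wordPerm_cons, hw, simple_mul_cancel]⟩

theorem len_wordPerm_le {n : ℕ} (l : List (Idx n)) : len (wordPerm l) ≤ l.length :=
  Nat.sInf_le ⟨l, rfl, rfl⟩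

theorem len_eq_card {n : ℕ} (w : Equiv.Perm (Fin n)) : len w = (inversions w).card := by
  apply le_antisymm
  · obtain ⟨l, hl, hw⟩ := exists_word_card_inversions w
    rw [← hl]
    conv_lhs => rw [← hw]
    exact len_wordPerm_le l
  · obtain ⟨l, hl, hw⟩ := exists_reduced w
    rw [← hl]
    conv_lhs => rw [← hw]
    exact card_inversions_wordPerm_le l

theorem len_one {n : ℕ} : len (1 : Equiv.Perm (Fin n)) = 0 := by
  rw [len_eq_card, inversions_one, Finset.card_empty]

theorem eq_one_of_len {n : ℕ} {w : Equiv.Perm (Fin n)} (h : len w = 0) : w = 1 := by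
  obtain ⟨l, hl, hw⟩ := exists_reduced w
  rw [h, List.length_eq_zero_iff] at hl
  rw [← hw, hl]
  rfl

theorem len_simple_mul_of_lt {n : ℕ} {a : Idx n} {w : Equiv.Perm (Fin n)}
    (h : w⁻¹ (lo a) < w⁻¹ (hi a)) : len (simple a * w) = len w + 1 := by
  rw [len_eq_card, len_eq_card, card_inversions_simple_mul h]

theorem len_simple_mul_of_gt {n : ℕ} {a : Idx n} {w : Equiv.Perm (Fin n)}
    (h : w⁻¹ (hi a) < w⁻¹ (lo a)) : len (simple a * w) + 1 = len w := by
  rw [len_eq_card, len_eq_card, card_inversions_simple_mul' h]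

theorem len_le_len_simple_mul_add_one {n : ℕ} (a : Idx n) (w : Equiv.Perm (Fin n)) :
    len w ≤ len (simple a * w) + 1 := by
  rcases inv_lo_lt_or a w⁻¹ with h | h
  · rw [len_simple_mul_of_lt h]; omega
  · rw [len_simple_mul_of_gt h]

theorem len_mul_le {n : ℕ} (w u : Equiv.Perm (Fin n)) : len (w * u) ≤ len w + len u := by
  obtain ⟨l, hl, hw⟩ := exists_reduced w
  obtain ⟨m, hm, hu⟩ := exists_reduced u
  rw [← hl, ← hm, ← List.length_append, ← hw, ← hu, ← wordPerm_append]
  exact len_wordPerm_le _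

theorem wordPerm_reverse {n : ℕ} (l : List (Idx n)) : wordPerm l.reverse = (wordPerm l)⁻¹ := by
  induction l with
  | nil => simp [wordPerm]
  | cons a l ih =>
    rw [List.reverse_cons, wordPerm_append, ih, wordPerm_cons a l, mul_inv_rev, simple_inv]
    simp [wordPerm]

theorem len_inv_le {n : ℕ} (w : Equiv.Perm (Fin n)) : len w⁻¹ ≤ len w := by
  obtain ⟨l, hl, hw⟩ := exists_reduced w
  rw [← hl, ← List.length_reverse]
  conv_lhs => rw [← hw, ← wordPerm_reverse]
  exact len_wordPerm_le _

theorem len_inv {n : ℕ} (w : Equiv.Perm (Fin n)) : len w⁻¹ = len w :=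
  le_antisymm (len_inv_le w) (by simpa using len_inv_le w⁻¹)

theorem len_mul_simple_of_lt {n : ℕ} {a : Idx n} {w : Equiv.Perm (Fin n)}
    (h : w (lo a) < w (hi a)) : len (w * simple a) = len w + 1 := by
  rw [← len_inv, mul_inv_rev, simple_inv, len_simple_mul_of_lt (by simpa using h), len_inv]

theorem len_mul_simple_of_gt {n : ℕ} {a : Idx n} {w : Equiv.Perm (Fin n)}
    (h : w (hi a) < w (lo a)) : len (w * simple a) + 1 = len w := by
  rw [← len_inv, mul_inv_rev, simple_inv, len_simple_mul_of_gt (by simpa using h), len_inv]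

/-! ### The parabolic subgroup `S_k × S_{n-k}` -/

theorem simple_lt_iff {n k : ℕ} {a : Idx n} (ha : a ∈ maxJ n k) (i : Fin n) :
    (simple a i).1 < k ↔ i.1 < k := by
  have h1 : a.1 ≠ k := ha
  have h2 := a.2
  rw [simple_eq, Equiv.swap_apply_def]
  simp only [lo, hi, Fin.ext_iff]
  split_ifs <;> simp only <;> omega

theorem parabolic_lt_iff {n k : ℕ} {u : Equiv.Perm (Fin n)} (hu : u ∈ parabolic (maxJ n k)) :
    ∀ i, (u i).1 < k ↔ i.1 < k := by
  induction hu using Subgroup.closure_induction with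
  | mem x hx =>
    obtain ⟨a, ha, rfl⟩ := hx
    exact simple_lt_iff ha
  | one => simp
  | mul x y _ _ hx hy => intro i; rw [Equiv.Perm.mul_apply, hx, hy]
  | inv x _ hx => intro i; rw [← hx, apply_inv_apply]

theorem simple_mem_parabolic {n : ℕ} {J : Set (Idx n)} {a : Idx n} (ha : a ∈ J) :
    simple a ∈ parabolic J := Subgroup.subset_closure ⟨a, ha, rfl⟩

/-- The generators are involutions, so no separate step for inverses is needed. -/
theorem parabolic_induction {n : ℕ} {J : Set (Idx n)} {p : Equiv.Perm (Fin n) → Prop}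
    (one : p 1) (step : ∀ a ∈ J, ∀ u ∈ parabolic J, p u → p (simple a * u))
    {u : Equiv.Perm (Fin n)} (hu : u ∈ parabolic J) : p u := by
  induction hu using Subgroup.closure_induction_left with
  | one => exact one
  | mul_left x hx y hy ih => obtain ⟨a, ha, rfl⟩ := hx; exact step a ha y hy ih
  | inv_mul_cancel x hx y hy ih =>
    obtain ⟨a, ha, rfl⟩ := hx; rw [simple_inv]; exact step a ha y hy ih

/-- Treats `S_n` as the case `k = 0`, so that the results on longest elements of `W_J` also cover
`w_0`. -/
theorem parabolic_maxJ_zero (n : ℕ) : parabolic (maxJ n 0) = ⊤ := by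
  rw [eq_top_iff]
  intro w _
  obtain ⟨l, rfl⟩ := exists_word w
  refine Subgroup.list_prod_mem _ fun x hx ↦ ?_
  obtain ⟨a, _, rfl⟩ := List.mem_map.mp hx
  exact simple_mem_parabolic (by have := a.2; change a.1 ≠ 0; omega)

theorem IsLongest.descent {n : ℕ} {J : Set (Idx n)} {w : Equiv.Perm (Fin n)}
    (hw : IsLongest (parabolic J) w) {a : Idx n} (ha : a ∈ J) : w (hi a) < w (lo a) := by
  rcases inv_lo_lt_or a w with h | h
  · have h1 := len_mul_simple_of_lt h
    have h2 := hw.2 _ (mul_mem hw.1 (simple_mem_parabolic ha))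
    omega
  · exact h

/-- The longest element of `S_k × S_{n-k}` reverses both blocks. -/
theorem IsLongest.apply_val {n k : ℕ} {w : Equiv.Perm (Fin n)} (hk : k ≤ n)
    (hw : IsLongest (parabolic (maxJ n k)) w) (i : Fin n) :
    (w i).1 = if i.1 < k then k - 1 - i.1 else n + k - 1 - i.1 := by
  have hb := parabolic_lt_iff hw.1
  have hd : ∀ (i : ℕ) (h : i + 1 < n), i + 1 ≠ k →
      (w ⟨i + 1, h⟩).1 < (w ⟨i, by omega⟩).1 := fun i h hik ↦
    hw.descent (a := ⟨i + 1, by omega, h⟩) hik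
  -- `w` is strictly decreasing on each block. Counting from the left end of a block bounds the
  -- values above (`up1`, `up2`), counting from the right end bounds them below (`dn1`, `dn2`), and
  -- the bounds coincide.
  have up1 : ∀ i (h : i < n), i < k → (w ⟨i, h⟩).1 + i ≤ k - 1 := by
    intro i
    induction i with
    | zero => intro h hi; have := (hb ⟨0, h⟩).mpr hi; omega
    | succ i ih =>
      intro h hi
      have := hd i h (by omega)
      have := ih (by omega) (by omega)
      omega
  have up2 : ∀ d (h : k + d < n), (w ⟨k + d, h⟩).1 + (k + d) ≤ n + k - 1 := by
    intro d
    induction d with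
    | zero => intro h; have := (w ⟨k + 0, h⟩).2; omega
    | succ d ih =>
      intro h
      have := hd (k + d) h (by omega)
      have := ih (by omega)
      simp only [← Nat.add_assoc] at *
      omega
  have dn1 : ∀ d (h : d < k), k - 1 ≤ (w ⟨k - 1 - d, by omega⟩).1 + (k - 1 - d) := by
    intro d
    induction d with
    | zero => intro h; omega
    | succ d ih =>
      intro h
      have h1 := hd (k - 1 - (d + 1)) (by omega) (by omega)
      have h2 := ih (by omega)
      have h3 : k - 1 - (d + 1) + 1 = k - 1 - d := by omega
      simp only [h3] at h1
      omega
  have dn2 : ∀ d (h : d < n - k), n + k - 1 ≤ (w ⟨n - 1 - d, by omega⟩).1 + (n - 1 - d) := by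
    intro d
    induction d with
    | zero =>
      intro h
      have := (hb ⟨n - 1 - 0, by omega⟩).not.mpr (by simp only; omega)
      omega
    | succ d ih =>
      intro h
      have h1 := hd (n - 1 - (d + 1)) (by omega) (by omega)
      have h2 := ih (by omega)
      have h3 : n - 1 - (d + 1) + 1 = n - 1 - d := by omega
      simp only [h3] at h1
      omega
  obtain ⟨i, h⟩ := i
  simp only
  split_ifs with hi
  · have h1 := up1 i h hi
    have h2 := dn1 (k - 1 - i) (by omega)
    have h3 : k - 1 - (k - 1 - i) = i := by omega
    simp only [h3] at h2
    omega
  · have h1 := up2 (i - k) (by omega)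
    have h2 := dn2 (n - 1 - i) (by omega)
    have h3 : n - 1 - (n - 1 - i) = i := by omega
    have h4 : k + (i - k) = i := by omega
    simp only [h3, h4] at h1 h2
    omega

/-- The longest element is unique, since its values are determined. Strictness is what puts the
lower coefficients of `parabolicSum` into `v ℤ[v]`. -/
theorem IsLongest.len_lt {n k : ℕ} (hk : k ≤ n) {w u : Equiv.Perm (Fin n)}
    (hw : IsLongest (parabolic (maxJ n k)) w) (hu : u ∈ parabolic (maxJ n k)) (hne : u ≠ w) :
    len u < len w := by
  refine lt_of_le_of_ne (hw.2 u hu) fun h ↦ hne ?_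
  have hu' : IsLongest (parabolic (maxJ n k)) u := ⟨hu, fun x hx ↦ h ▸ hw.2 x hx⟩
  ext i
  rw [hu'.apply_val hk, hw.apply_val hk]

/-! ### Minimal coset representatives -/

/-- A descent inside a block would make `z * simple a` shorter than `z` for some `a ∈ J`. -/
theorem minReps_lt {n k : ℕ} {z : Equiv.Perm (Fin n)} (hz : z ∈ minReps (maxJ n k)) {i j : Fin n}
    (hij : i < j) (hb : i.1 < k ↔ j.1 < k) : z i < z j := by
  obtain ⟨i, hi⟩ := i
  obtain ⟨j, hj⟩ := j
  simp only [Fin.mk_lt_mk] at hij hb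
  obtain ⟨d, rfl⟩ := Nat.exists_eq_add_of_lt hij
  have key : ∀ (i : ℕ) (h : i + 1 < n), i + 1 ≠ k → z ⟨i, by omega⟩ < z ⟨i + 1, h⟩ := by
    intro i h hik
    rcases inv_lo_lt_or ⟨i + 1, by omega, h⟩ z with h1 | h1
    · exact h1
    · have h2 := len_mul_simple_of_gt h1
      have h3 := hz _ (simple_mem_parabolic (a := ⟨i + 1, by omega, h⟩) hik)
      omega
  clear hij
  induction d with
  | zero => exact key i hj (by omega)
  | succ d ih =>
    exact lt_trans (ih (by omega) (by omega) key) (key (i + d + 1) (by omega) (by omega))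

/-- `z` is increasing on each block and `u` preserves the blocks, so right multiplication by `s_a`,
`a ∈ J`, changes the lengths of `u` and `z * u` alike. -/
theorem len_mul_of_minReps {n k : ℕ} {z u : Equiv.Perm (Fin n)} (hz : z ∈ minReps (maxJ n k))
    (hu : u ∈ parabolic (maxJ n k)) : len (z * u) = len z + len u := by
  have hu' : u⁻¹ ∈ parabolic (maxJ n k) := inv_mem hu
  -- Inverses turn the left steps of `parabolic_induction` into the right steps needed here.
  suffices h : ∀ u ∈ parabolic (maxJ n k), len (z * u⁻¹) = len z + len u⁻¹ by
    simpa using h _ hu'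
  intro u hu
  refine parabolic_induction (p := fun u ↦ len (z * u⁻¹) = len z + len u⁻¹) ?_ ?_ hu
  · simp [len_one]
  · intro a ha u hu ih
    have hb : (u⁻¹ (lo a)).1 < k ↔ (u⁻¹ (hi a)).1 < k := by
      rw [parabolic_lt_iff (inv_mem hu), parabolic_lt_iff (inv_mem hu)]
      have h1 : a.1 ≠ k := ha
      have h2 := a.2
      simp only [lo, hi]
      omega
    rw [mul_inv_rev, simple_inv, ← mul_assoc]
    rcases inv_lo_lt_or a u⁻¹ with h | h
    · have h1 := len_mul_simple_of_lt h
      have h2 := len_mul_simple_of_lt (a := a) (w := z * u⁻¹) (minReps_lt hz h hb)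
      omega
    · have h1 := len_mul_simple_of_gt h
      have h2 := len_mul_simple_of_gt (a := a) (w := z * u⁻¹) (minReps_lt hz h hb.symm)
      omega

theorem minReps_eq_of_mul_eq {n k : ℕ} {z z' u u' : Equiv.Perm (Fin n)}
    (hz : z ∈ minReps (maxJ n k)) (hz' : z' ∈ minReps (maxJ n k))
    (hu : u ∈ parabolic (maxJ n k)) (hu' : u' ∈ parabolic (maxJ n k)) (h : z * u = z' * u') :
    z = z' := by
  have h1 : z = z' * (u' * u⁻¹) := by rw [← mul_assoc, ← h, mul_inv_cancel_right]
  have hm : u' * u⁻¹ ∈ parabolic (maxJ n k) := mul_mem hu' (inv_mem hu)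
  have h2 := len_mul_of_minReps hz' hm
  rw [← h1] at h2
  have h3 := hz _ (inv_mem hm)
  have h4 : z * (u' * u⁻¹)⁻¹ = z' := by rw [h1, mul_inv_cancel_right]
  rw [h4] at h3
  rw [h1, eq_one_of_len (w := u' * u⁻¹) (by omega), mul_one]

theorem exists_minReps_mul {n : ℕ} (J : Set (Idx n)) (w : Equiv.Perm (Fin n)) :
    ∃ z ∈ minReps J, ∃ u ∈ parabolic J, w = z * u := by
  obtain ⟨u, hu⟩ := exists_minimalFor_of_wellFoundedLT (· ∈ parabolic J)
    (fun u ↦ len (w * u)) ⟨1, one_mem _⟩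
  refine ⟨w * u, fun x hx ↦ ?_, u⁻¹, inv_mem hu.1, by simp⟩
  rw [mul_assoc]
  rcases le_total (len (w * u)) (len (w * (u * x))) with h | h
  · exact h
  · exact hu.2 (mul_mem hu.1 hx) h

/-! ### The regular representation on functions on `S_n` -/

/-- The operator of `T_a` on functions on `S_n`: on coefficient functions, it is left
multiplication by `T_a` with respect to the basis `T_w`. -/
def opT {n : ℕ} (a : Idx n) :
    (Equiv.Perm (Fin n) → Qv) →ₗ[Qv] (Equiv.Perm (Fin n) → Qv) where
  toFun f w := f (simple a * w) + if w⁻¹ (hi a) < w⁻¹ (lo a) then (v - v⁻¹) * f w else 0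
  map_add' f g := by
    ext w
    simp only [Pi.add_apply]
    split_ifs <;> ring
  map_smul' c f := by
    ext w
    simp only [Pi.smul_apply, smul_eq_mul, RingHom.id_apply]
    split_ifs <;> ring

theorem opT_apply {n : ℕ} (a : Idx n) (f : Equiv.Perm (Fin n) → Qv) (w : Equiv.Perm (Fin n)) :
    opT a f w =
      f (simple a * w) + if w⁻¹ (hi a) < w⁻¹ (lo a) then (v - v⁻¹) * f w else 0 := rfl

theorem opT_quad {n : ℕ} (a : Idx n) :
    (opT a - algebraMap Qv (Module.End Qv (Equiv.Perm (Fin n) → Qv)) v) *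
      (opT a + algebraMap Qv (Module.End Qv (Equiv.Perm (Fin n) → Qv)) v⁻¹) = 0 := by
  refine LinearMap.ext fun f ↦ funext fun w ↦ ?_
  have hv := mul_inv_cancel₀ v_ne_zero
  simp only [Module.End.mul_apply, LinearMap.sub_apply, LinearMap.add_apply,
    Module.algebraMap_end_apply, map_add, map_smul, Pi.add_apply, Pi.sub_apply, Pi.smul_apply,
    smul_eq_mul, opT_apply, simple_mul_cancel, mul_inv_rev, simple_inv, Equiv.Perm.mul_apply,
    simple_lo, simple_hi, LinearMap.zero_apply, Pi.zero_apply]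
  rcases inv_lo_lt_or a w⁻¹ with h | h
  · simp only [h, h.not_gt, if_true, if_false]
    linear_combination (-f w) * hv
  · simp only [h, h.not_gt, if_true, if_false]
    linear_combination (-f w) * hv

theorem hi_eq_lo {n : ℕ} {a b : Idx n} (h : a.1 + 1 = b.1) : hi a = lo b := by
  simp only [hi, lo, Fin.ext_iff]
  omega

theorem simple_hi_of_lt {n : ℕ} {a b : Idx n} (h : a.1 < b.1) : simple a (hi b) = hi b := by
  have ha := a.2
  apply Equiv.swap_apply_of_ne_of_ne <;> simp only [hi, ne_eq, Fin.ext_iff] <;> omega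

theorem simple_lo_of_lt {n : ℕ} {a b : Idx n} (h : a.1 < b.1) : simple b (lo a) = lo a := by
  have ha := a.2
  apply Equiv.swap_apply_of_ne_of_ne <;> simp only [lo, ne_eq, Fin.ext_iff] <;> omega

theorem simple_lo_of_succ_lt {n : ℕ} {a b : Idx n} (h : a.1 + 1 < b.1) :
    simple a (lo b) = lo b := by
  have ha := a.2
  apply Equiv.swap_apply_of_ne_of_ne <;> simp only [lo, ne_eq, Fin.ext_iff] <;> omega

theorem simple_hi_of_succ_lt {n : ℕ} {a b : Idx n} (h : a.1 + 1 < b.1) :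
    simple b (hi a) = hi a := by
  have ha := a.2
  apply Equiv.swap_apply_of_ne_of_ne <;> simp only [hi, ne_eq, Fin.ext_iff] <;> omega

theorem simple_braid {n : ℕ} {a b : Idx n} (h : a.1 + 1 = b.1) :
    simple a * (simple b * simple a) = simple b * (simple a * simple b) := by
  have h1 : lo a ≠ hi b := by simp only [lo, hi, ne_eq, Fin.ext_iff]; omega
  have h2 := (lo_lt_hi a).ne
  have h3 := (lo_lt_hi b).ne
  rw [← mul_assoc, ← mul_assoc, simple_eq, simple_eq, hi_eq_lo h] at *
  rw [Equiv.swap_mul_swap_mul_swap h2 h1, Equiv.swap_comm (lo a), Equiv.swap_comm (lo b) (hi b),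
    Equiv.swap_mul_swap_mul_swap h3.symm h1.symm]
  exact Equiv.swap_comm _ _

theorem simple_comm {n : ℕ} {a b : Idx n} (h : a.1 + 1 < b.1) :
    simple a * simple b = simple b * simple a := by
  rw [simple_eq b, Equiv.mul_swap_eq_swap_mul, simple_lo_of_succ_lt h, simple_hi_of_lt (by omega)]

theorem simple_braid_mul {n : ℕ} {a b : Idx n} (h : a.1 + 1 = b.1) (w : Equiv.Perm (Fin n)) :
    simple a * (simple b * (simple a * w)) = simple b * (simple a * (simple b * w)) := by
  have := congrArg (· * w) (simple_braid h)
  simpa only [mul_assoc] using this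

theorem simple_comm_mul {n : ℕ} {a b : Idx n} (h : a.1 + 1 < b.1) (w : Equiv.Perm (Fin n)) :
    simple a * (simple b * w) = simple b * (simple a * w) := by
  rw [← mul_assoc, simple_comm h, mul_assoc]

/-- Both sides depend only on the relative order of the positions of three consecutive letters in
`w`. The six orders are checked one by one; the two cyclic sign patterns are impossible. -/
theorem opT_braid {n : ℕ} (a b : Idx n) (h : a.1 + 1 = b.1) :
    opT a * opT b * opT a = opT b * opT a * opT b := by
  have ha := a.2
  have hb := b.2
  have e1 := hi_eq_lo h
  have e2 : simple a (hi b) = hi b := simple_hi_of_lt (by omega)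
  have e3 : simple b (lo a) = lo a := simple_lo_of_lt (by omega)
  have e4 : simple a (lo b) = lo a := by rw [← e1, simple_hi]
  refine LinearMap.ext fun f ↦ funext fun w ↦ ?_
  simp only [Module.End.mul_apply, opT_apply, mul_inv_rev, simple_inv, Equiv.Perm.mul_apply,
    simple_lo, simple_hi, e1, e2, e3, e4, simple_mul_cancel, simple_braid_mul h]
  have hne : w⁻¹ (lo a) ≠ w⁻¹ (hi b) := by
    simp only [ne_eq, EmbeddingLike.apply_eq_iff_eq, lo, hi, Fin.ext_iff]
    omega
  have h1 := inv_lo_lt_or a w⁻¹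
  rw [e1] at h1
  rcases h1 with h1 | h1 <;> rcases inv_lo_lt_or b w⁻¹ with h2 | h2 <;>
    rcases lt_or_gt_of_ne hne with h3 | h3 <;>
    simp only [h1, h2, h3, h1.not_gt, h2.not_gt, h3.not_gt, if_true, if_false] <;>
    first
    | ring1
    | exact absurd (h1.trans h2) h3.not_gt
    | exact absurd (h2.trans h1) h3.not_gt

theorem opT_comm {n : ℕ} (a b : Idx n) (h : a.1 + 1 < b.1) : opT a * opT b = opT b * opT a := by
  have e1 : simple a (hi b) = hi b := simple_hi_of_lt (by omega)
  have e2 := simple_lo_of_succ_lt h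
  have e3 := simple_hi_of_succ_lt h
  have e4 : simple b (lo a) = lo a := simple_lo_of_lt (by omega)
  refine LinearMap.ext fun f ↦ funext fun w ↦ ?_
  simp only [Module.End.mul_apply, opT_apply, mul_inv_rev, simple_inv, Equiv.Perm.mul_apply,
    e1, e2, e3, e4, simple_comm_mul h]
  split_ifs <;> ring

/-- The algebra map from the free algebra underlying the regular representation. -/
def preRho (n : ℕ) : FreeAlgebra Qv (Idx n) →ₐ[Qv] Module.End Qv (Equiv.Perm (Fin n) → Qv) :=
  FreeAlgebra.lift Qv opT

theorem preRho_ι {n : ℕ} (a : Idx n) : preRho n (FreeAlgebra.ι Qv a) = opT a :=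
  FreeAlgebra.lift_ι_apply _ _

theorem preRho_rel (n : ℕ) {x y : FreeAlgebra Qv (Idx n)} (h : HeckeRel n x y) :
    preRho n x = preRho n y := by
  cases h with
  | quad a =>
    rw [map_mul, map_sub, map_add, map_zero, AlgHom.commutes, AlgHom.commutes, preRho_ι]
    exact opT_quad a
  | braid a b h =>
    simp only [map_mul, preRho_ι]
    exact opT_braid a b h
  | comm a b h =>
    simp only [map_mul, preRho_ι]
    exact opT_comm a b h

/-- The regular representation of `H`. -/
def rho (n : ℕ) : Hecke n →ₐ[Qv] Module.End Qv (Equiv.Perm (Fin n) → Qv) :=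
  RingQuot.liftAlgHom Qv ⟨preRho n, fun _ _ h ↦ preRho_rel n h⟩

theorem rho_T {n : ℕ} (a : Idx n) : rho n (T a) = opT a :=
  (RingQuot.liftAlgHom_mkAlgHom_apply Qv (preRho n) (fun _ _ h ↦ preRho_rel n h) _).trans
    (preRho_ι a)

/-- The coefficients of an element of `H` with respect to the elements `T_w`. -/
def coeffs (n : ℕ) : Hecke n →ₗ[Qv] (Equiv.Perm (Fin n) → Qv) :=
  (LinearMap.applyₗ (Pi.single 1 1)).comp (rho n).toLinearMap

theorem coeffs_apply {n : ℕ} (h : Hecke n) : coeffs n h = rho n h (Pi.single 1 1) := rfl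

theorem coeffs_one (n : ℕ) : coeffs n 1 = Pi.single 1 1 := by
  rw [coeffs_apply, map_one, Module.End.one_apply]

theorem coeffs_T_mul {n : ℕ} (a : Idx n) (h : Hecke n) (w : Equiv.Perm (Fin n)) :
    coeffs n (T a * h) w = coeffs n h (simple a * w) +
      if w⁻¹ (hi a) < w⁻¹ (lo a) then (v - v⁻¹) * coeffs n h w else 0 := by
  rw [coeffs_apply, map_mul, Module.End.mul_apply, rho_T, opT_apply]
  rfl

theorem cst_mul {n : ℕ} (c : Qv) (h : Hecke n) : cst n c * h = c • h :=
  (Algebra.smul_def c h).symm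

theorem coeffs_cst_mul {n : ℕ} (c : Qv) (h : Hecke n) (w : Equiv.Perm (Fin n)) :
    coeffs n (cst n c * h) w = c * coeffs n h w := by
  rw [cst_mul, map_smul, Pi.smul_apply, smul_eq_mul]

/-- Multiplying on the left by `∏ (T_a - c_a)` has the expected leading coefficient. -/
theorem coeffs_prod_mul {n : ℕ} (l : List (Idx n × Qv)) (h : Hecke n) (u : Equiv.Perm (Fin n))
    (hu : ∀ w, len u ≤ len w → coeffs n h w = if w = u then 1 else 0) (w : Equiv.Perm (Fin n))
    (hw : l.length + len u ≤ len w) :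
    coeffs n ((l.map fun p ↦ T p.1 - cst n p.2).prod * h) w =
      if w = wordPerm (l.map Prod.fst) * u then 1 else 0 := by
  induction l generalizing w with
  | nil => simpa [wordPerm] using hu w (by simpa using hw)
  | cons p l ih =>
    obtain ⟨a, c⟩ := p
    simp only [List.length_cons] at hw
    simp only [List.map_cons, List.prod_cons, wordPerm_cons, mul_assoc, sub_mul, map_sub,
      Pi.sub_apply, coeffs_T_mul, coeffs_cst_mul]
    -- `w` is too long to be the leading term of the shorter product, so the constant `c`
    -- contributes nothing.
    have h0 : w ≠ wordPerm (l.map Prod.fst) * u := by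
      rintro rfl
      have h1 := len_mul_le (wordPerm (l.map Prod.fst)) u
      have h2 := len_wordPerm_le (l.map Prod.fst)
      rw [List.length_map] at h2
      omega
    have h1 := len_le_len_simple_mul_add_one a w
    rw [ih w (by omega), ih (simple a * w) (by omega), if_neg h0]
    have h2 : (simple a * w = wordPerm (l.map Prod.fst) * u) ↔
        (w = simple a * (wordPerm (l.map Prod.fst) * u)) := by
      rw [← inv_mul_eq_iff_eq_mul (a := simple a), simple_inv]
    simp [h2]

theorem len_wordPerm_tail {n : ℕ} {a : Idx n} {l : List (Idx n)}
    (h : len (wordPerm (a :: l)) = (a :: l).length) : len (wordPerm l) = l.length := by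
  rw [wordPerm_cons, List.length_cons] at h
  have h1 := len_wordPerm_le l
  have h2 := len_le_len_simple_mul_add_one a (simple a * wordPerm l)
  rw [simple_mul_cancel] at h2
  omega

theorem coeffs_prod_of_reduced {n : ℕ} (l : List (Idx n)) (h : len (wordPerm l) = l.length) :
    coeffs n (l.map T).prod = Pi.single (wordPerm l) 1 := by
  induction l with
  | nil => simp [wordPerm, coeffs_one]
  | cons a l ih =>
    have ih := ih (len_wordPerm_tail h)
    have h1 : (wordPerm l)⁻¹ (lo a) < (wordPerm l)⁻¹ (hi a) := by
      refine (inv_lo_lt_or a _).resolve_right fun h2 ↦ ?_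
      have h3 := len_simple_mul_of_gt h2
      have h4 := len_wordPerm_le l
      rw [wordPerm_cons, List.length_cons] at h
      omega
    ext w
    rw [List.map_cons, List.prod_cons, coeffs_T_mul, ih, wordPerm_cons]
    have h2 : (simple a * w = wordPerm l) ↔ (w = simple a * wordPerm l) := by
      rw [← inv_mul_eq_iff_eq_mul (a := simple a), simple_inv]
    simp only [Pi.single_apply, h2]
    by_cases hw : w = wordPerm l
    · subst hw
      rw [if_neg h1.not_gt]
      simp
    · simp [hw]

theorem coeffs_Tw {n : ℕ} (w : Equiv.Perm (Fin n)) : coeffs n (Tw w) = Pi.single w 1 := by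
  obtain ⟨h1, h2⟩ := (exists_reduced w).choose_spec
  have h := coeffs_prod_of_reduced (reducedWord w) (by rw [reducedWord, h1, h2])
  rw [Tw, h, reducedWord, h2]

theorem coeffs_surjective (n : ℕ) : Function.Surjective (coeffs n) := by
  intro f
  refine ⟨∑ w, f w • Tw w, ?_⟩
  rw [map_sum]
  simp only [map_smul, coeffs_Tw]
  ext w
  simp [Finset.sum_apply, Pi.single_apply]

/-! ### The dimension of `H` -/

/-- The generator `T_a`, with value `0` for `a` out of range. -/
def Tn (n a : ℕ) : Hecke n := if h : 1 ≤ a ∧ a < n then T ⟨a, h⟩ else 0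

theorem Tn_val {n : ℕ} (a : Idx n) : Tn n a.1 = T a := dif_pos a.2

theorem Tn_comm {n a b : ℕ} (h : a + 1 < b) : Tn n a * Tn n b = Tn n b * Tn n a := by
  unfold Tn
  split_ifs with ha hb
  · exact T_comm ⟨a, ha⟩ ⟨b, hb⟩ h
  all_goals simp

theorem Tn_braid {n a : ℕ} (h1 : 1 ≤ a) (h2 : a + 1 < n) :
    Tn n a * Tn n (a + 1) * Tn n a = Tn n (a + 1) * Tn n a * Tn n (a + 1) := by
  have := T_braid (n := n) ⟨a, by omega⟩ ⟨a + 1, by omega⟩ rfl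
  rwa [← Tn_val, ← Tn_val] at this

theorem T_mul_self {n : ℕ} (a : Idx n) : T a * T a = (v - v⁻¹) • T a + 1 := by
  have h := T_mul_Tinv a
  rw [Tinv, mul_add, mul_sub, ← Algebra.commutes, ← Algebra.commutes, ← Algebra.smul_def,
    ← Algebra.smul_def] at h
  rw [sub_smul, ← h]
  abel

theorem Tn_mul_self {n a : ℕ} (h1 : 1 ≤ a) (h2 : a < n) :
    Tn n a * Tn n a = (v - v⁻¹) • Tn n a + 1 := by
  have := T_mul_self (n := n) ⟨a, h1, h2⟩
  rwa [← Tn_val] at this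

/-- The product `T_m T_{m-1} ⋯` with `d` factors. -/
def desc (n m : ℕ) : ℕ → Hecke n
  | 0 => 1
  | d + 1 => desc n m d * Tn n (m - d)

theorem desc_commute {n m d a : ℕ} (h : a + d < m) : Tn n a * desc n m d = desc n m d * Tn n a := by
  induction d with
  | zero => simp [desc]
  | succ d ih =>
    rw [desc, ← mul_assoc, ih (by omega), mul_assoc, Tn_comm (by omega), ← mul_assoc]

/-- Both `T_a` and `T_{a-1}` occur in the product. The new `T_a` passes the factors below `T_{a-1}`,
the braid relation turns it into a `T_{a-1}` on the left, and this passes the factors above `T_a`.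
-/
theorem desc_mul_Tn {n m d a : ℕ} (hm : m < n) (hd : d ≤ m) (ha : a ≤ m) (had : m < a - 1 + d) :
    desc n m d * Tn n a = Tn n (a - 1) * desc n m d := by
  induction d with
  | zero => omega
  | succ d ih =>
    by_cases h : m < a - 1 + d
    · rw [desc, mul_assoc, Tn_comm (by omega), ← mul_assoc, ih (by omega) h, mul_assoc]
    · obtain ⟨e, rfl⟩ : ∃ e, d = e + 1 := ⟨d - 1, by omega⟩
      obtain ⟨b, rfl⟩ : ∃ b, a = b + 1 := ⟨a - 1, by omega⟩
      have h1 : m - e = b + 1 := by omega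
      have h2 : m - (e + 1) = b := by omega
      simp only [desc, h1, h2, Nat.add_sub_cancel]
      rw [mul_assoc (desc n m e), mul_assoc (desc n m e), ← Tn_braid (by omega) (by omega),
        ← mul_assoc, ← mul_assoc, ← desc_commute (by omega)]
      simp only [mul_assoc]

open Classical in
instance (n : ℕ) : DecidableEq (Hecke n) := inferInstance

/-- The normal forms in the generators `T_1, …, T_{m-1}`. -/
def normalForms (n : ℕ) : ℕ → Finset (Hecke n)
  | 0 => {1}
  | m + 1 => (normalForms n m ×ˢ Finset.range (m + 1)).image fun p ↦ p.1 * desc n m p.2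

theorem card_normalForms (n m : ℕ) : (normalForms n m).card ≤ m.factorial := by
  induction m with
  | zero => simp [normalForms]
  | succ m ih =>
    refine Finset.card_image_le.trans ?_
    rw [Finset.card_product, Finset.card_range, Nat.factorial_succ, mul_comm]
    exact Nat.mul_le_mul_left _ ih

theorem mul_mem_span_normalForms {n m d : ℕ} (hd : d ≤ m) {x : Hecke n}
    (hx : x ∈ Submodule.span Qv (normalForms n m : Set (Hecke n))) :
    x * desc n m d ∈ Submodule.span Qv (normalForms n (m + 1) : Set (Hecke n)) := by
  induction hx using Submodule.span_induction with
  | mem x hx =>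
    refine Submodule.subset_span ?_
    rw [normalForms, Finset.mem_coe, Finset.mem_image]
    exact ⟨(x, d), by simpa using ⟨hx, by omega⟩, rfl⟩
  | zero => rw [zero_mul]; exact zero_mem _
  | add x y _ _ hx hy => rw [add_mul]; exact add_mem hx hy
  | smul c x _ hx => rw [smul_mul_assoc]; exact Submodule.smul_mem _ _ hx

/-- Against the descending tail of a normal form, `T_a` commutes, prolongs the tail, squares its
last factor, or passes with its index lowered by one. In the first and last cases it then acts on a
shorter normal form, covered by induction. -/
theorem span_normalForms_mul_Tn {n m a : ℕ} (hm : m ≤ n) (ha : 1 ≤ a) (ham : a < m) {x : Hecke n}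
    (hx : x ∈ Submodule.span Qv (normalForms n m : Set (Hecke n))) :
    x * Tn n a ∈ Submodule.span Qv (normalForms n m : Set (Hecke n)) := by
  induction m generalizing a x with
  | zero => omega
  | succ m ih =>
    induction hx using Submodule.span_induction with
    | zero => rw [zero_mul]; exact zero_mem _
    | add x y _ _ hx hy => rw [add_mul]; exact add_mem hx hy
    | smul c x _ hx => rw [smul_mul_assoc]; exact Submodule.smul_mem _ _ hx
    | mem x hx =>
      rw [normalForms, Finset.mem_coe, Finset.mem_image] at hx
      obtain ⟨⟨y, d⟩, hy, rfl⟩ := hx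
      obtain ⟨hy0, hd⟩ : y ∈ normalForms n m ∧ d < m + 1 := by simpa using hy
      have hy1 := Submodule.subset_span (R := Qv) (Finset.mem_coe.mpr hy0)
      simp only
      rcases lt_trichotomy (a + d) m with h | h | h
      · rw [mul_assoc, ← desc_commute h, ← mul_assoc]
        exact mul_mem_span_normalForms (by omega) (ih (by omega) ha (by omega) hy1)
      · have h1 : desc n m d * Tn n a = desc n m (d + 1) := by
          rw [desc, show m - d = a by omega]
        rw [mul_assoc, h1]
        exact mul_mem_span_normalForms (by omega) hy1
      · by_cases h2 : a + d = m + 1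
        · obtain ⟨e, rfl⟩ : ∃ e, d = e + 1 := ⟨d - 1, by omega⟩
          have h1 : desc n m (e + 1) * Tn n a =
              (v - v⁻¹) • desc n m (e + 1) + desc n m e := by
            rw [desc, show m - e = a by omega, mul_assoc, Tn_mul_self ha (by omega), mul_add,
              mul_one, mul_smul_comm]
          rw [mul_assoc, h1, mul_add, mul_smul_comm]
          exact add_mem (Submodule.smul_mem _ _ (mul_mem_span_normalForms (by omega) hy1))
            (mul_mem_span_normalForms (by omega) hy1)
        · rw [mul_assoc, desc_mul_Tn (by omega) (by omega) (by omega) (by omega), ← mul_assoc]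
          exact mul_mem_span_normalForms (by omega) (ih (by omega) (by omega) (by omega) hy1)

theorem one_mem_normalForms (n m : ℕ) :
    (1 : Hecke n) ∈ Submodule.span Qv (normalForms n m : Set (Hecke n)) := by
  induction m with
  | zero => exact Submodule.subset_span (by simp [normalForms])
  | succ m ih => simpa [desc] using mul_mem_span_normalForms (Nat.zero_le m) ih

theorem heckeMk_surjective (n : ℕ) : Function.Surjective (heckeMk n) :=
  RingQuot.mkAlgHom_surjective Qv (HeckeRel n)

/-- A subspace containing `1` and stable under right multiplication by the generators is
everything. -/
theorem span_normalForms (n : ℕ) :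
    Submodule.span Qv (normalForms n n : Set (Hecke n)) = ⊤ := by
  rw [eq_top_iff]
  intro h _
  obtain ⟨x, rfl⟩ := heckeMk_surjective n h
  suffices hs : ∀ y ∈ Submodule.span Qv (normalForms n n : Set (Hecke n)),
      y * heckeMk n x ∈ Submodule.span Qv (normalForms n n : Set (Hecke n)) by
    simpa using hs 1 (one_mem_normalForms n n)
  induction x using FreeAlgebra.induction with
  | grade0 c =>
    intro y hy
    rw [AlgHom.commutes, ← Algebra.commutes, ← Algebra.smul_def]
    exact Submodule.smul_mem _ _ hy
  | grade1 a =>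
    intro y hy
    have := span_normalForms_mul_Tn (a := a.1) le_rfl a.2.1 a.2.2 hy
    rwa [Tn_val] at this
  | mul p q hp hq =>
    intro y hy
    rw [map_mul, ← mul_assoc]
    exact hq trivial _ (hp trivial _ hy)
  | add p q hp hq =>
    intro y hy
    rw [map_add, mul_add]
    exact add_mem (hp trivial _ hy) (hq trivial _ hy)

/-- The normal forms bound the dimension of `H` by `n!`, which is the dimension of the target of the
surjection `coeffs`. -/
theorem coeffs_injective (n : ℕ) : Function.Injective (coeffs n) := by
  have hfin : Module.Finite Qv (Hecke n) :=
    ⟨⟨normalForms n n, span_normalForms n⟩⟩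
  have h1 : Module.finrank Qv (Hecke n) ≤ n.factorial := by
    rw [← finrank_top, ← span_normalForms]
    exact (finrank_span_finset_le_card _).trans (card_normalForms n n)
  have h2 : Module.finrank Qv (Equiv.Perm (Fin n) → Qv) = n.factorial := by
    rw [Module.finrank_pi, Fintype.card_perm, Fintype.card_fin]
  have h3 := LinearMap.finrank_le_finrank_of_surjective (coeffs_surjective n)
  exact (LinearMap.injective_iff_surjective_of_finrank_eq_finrank (by omega)).mpr
    (coeffs_surjective n)

theorem Tw_expansion {n : ℕ} (h : Hecke n) : h = ∑ w, coeffs n h w • Tw w := by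
  apply coeffs_injective n
  rw [map_sum]
  simp only [map_smul, coeffs_Tw]
  ext w
  simp [Finset.sum_apply, Pi.single_apply]

/-- Independence of the reduced word, obtained by comparing coefficients instead of by Matsumoto's
theorem. -/
theorem prod_eq_Tw {n : ℕ} (l : List (Idx n)) (h : len (wordPerm l) = l.length) :
    (l.map T).prod = Tw (wordPerm l) :=
  coeffs_injective n (by rw [coeffs_prod_of_reduced l h, coeffs_Tw])

theorem Tw_one (n : ℕ) : Tw (1 : Equiv.Perm (Fin n)) = 1 :=
  coeffs_injective n (by rw [coeffs_Tw, coeffs_one])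

theorem Tw_mul_Tw {n : ℕ} {w u : Equiv.Perm (Fin n)} (h : len (w * u) = len w + len u) :
    Tw w * Tw u = Tw (w * u) := by
  obtain ⟨h1, h2⟩ := (exists_reduced w).choose_spec
  obtain ⟨h3, h4⟩ := (exists_reduced u).choose_spec
  have h5 : wordPerm (reducedWord w ++ reducedWord u) = w * u := by
    rw [wordPerm_append, reducedWord, reducedWord, h2, h4]
  rw [Tw, Tw, ← List.prod_append, ← List.map_append, prod_eq_Tw, h5]
  rw [h5, h, List.length_append, reducedWord, reducedWord, h1, h3]

theorem T_mul_Tw_of_lt {n : ℕ} {a : Idx n} {w : Equiv.Perm (Fin n)}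
    (h : w⁻¹ (lo a) < w⁻¹ (hi a)) : T a * Tw w = Tw (simple a * w) := by
  have h1 : wordPerm [a] = simple a := by simp [wordPerm]
  have h2 : len (simple a) = 1 := by
    have := len_simple_mul_of_lt (a := a) (w := 1) (by simpa using lo_lt_hi a)
    rwa [mul_one, len_one] at this
  have h3 : T a = Tw (simple a) := by
    rw [← h1, ← prod_eq_Tw [a] (by rw [h1, h2]; rfl)]
    simp
  rw [h3, Tw_mul_Tw]
  rw [h2, len_simple_mul_of_lt h, add_comm]

theorem T_mul_Tw_of_gt {n : ℕ} {a : Idx n} {w : Equiv.Perm (Fin n)}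
    (h : w⁻¹ (hi a) < w⁻¹ (lo a)) : T a * Tw w = Tw (simple a * w) + (v - v⁻¹) • Tw w := by
  have h1 := T_mul_Tw_of_lt (a := a) (w := simple a * w) (by simpa using h)
  rw [simple_mul_cancel] at h1
  rw [← h1, ← mul_assoc, T_mul_self, add_mul, one_mul, smul_mul_assoc, h1, add_comm]

/-! ### The lattice `v ℤ[v]` -/

theorem InVZv.zero : InVZv 0 := ⟨0, by simp⟩

theorem InVZv.sub {c d : Qv} (hc : InVZv c) (hd : InVZv d) : InVZv (c - d) := by
  obtain ⟨p, rfl⟩ := hc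
  obtain ⟨q, rfl⟩ := hd
  exact ⟨p - q, by rw [map_sub, mul_sub]⟩

theorem InVZv.add {c d : Qv} (hc : InVZv c) (hd : InVZv d) : InVZv (c + d) := by
  obtain ⟨p, rfl⟩ := hc
  obtain ⟨q, rfl⟩ := hd
  exact ⟨p + q, by rw [map_add, mul_add]⟩

theorem InVZv.sum {ι : Type*} {s : Finset ι} {f : ι → Qv} (h : ∀ i ∈ s, InVZv (f i)) :
    InVZv (∑ i ∈ s, f i) :=
  Finset.sum_induction _ _ (fun _ _ ↦ InVZv.add) InVZv.zero h

theorem InVZv.mul_neg_pow {c : Qv} (hc : InVZv c) (m : ℕ) : InVZv (c * (-v) ^ m) := by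
  obtain ⟨p, rfl⟩ := hc
  exact ⟨p * (-Polynomial.X) ^ m, by simp [mul_assoc]⟩

theorem inVZv_neg_pow {m : ℕ} (hm : m ≠ 0) : InVZv ((-v) ^ m) := by
  obtain ⟨m, rfl⟩ := Nat.exists_eq_succ_of_ne_zero hm
  exact ⟨-(-Polynomial.X) ^ m, by simp [pow_succ']⟩

theorem aeval_v_injective : Function.Injective (Polynomial.aeval (R := ℤ) v) := by
  have h : ∀ p : ℤ[X], Polynomial.aeval v p =
      algebraMap ℚ[X] Qv (p.map (Int.castRingHom ℚ)) := by
    intro p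
    induction p using Polynomial.induction_on' with
    | add p q hp hq => rw [map_add, hp, hq, Polynomial.map_add, map_add]
    | monomial m c =>
      rw [Polynomial.aeval_monomial, Polynomial.map_monomial, ← Polynomial.C_mul_X_pow_eq_monomial]
      simp [v]
  intro p q hpq
  rw [h, h] at hpq
  exact Polynomial.map_injective _ (RingHom.injective_int _)
    (IsFractionRing.injective ℚ[X] Qv hpq)

theorem barQv_aeval (p : ℤ[X]) : barQv (Polynomial.aeval v p) = Polynomial.aeval v⁻¹ p := by
  induction p using Polynomial.induction_on' with
  | add p q hp hq => rw [map_add, map_add, map_add, hp, hq]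
  | monomial m c => simp [Polynomial.aeval_monomial, barQv_v]

/-- If `v p(v) = v⁻¹ p(v⁻¹)`, then the reverse of `p` is `X ^ (deg p + 2) * p`, whose degree is too
large unless `p = 0`. -/
theorem InVZv.eq_zero {c : Qv} (hc : InVZv c) (h : barQv c = c) : c = 0 := by
  obtain ⟨p, rfl⟩ := hc
  rw [map_mul, barQv_v, barQv_aeval] at h
  have hv := v_ne_zero
  have hrev : Polynomial.aeval v p.reverse = Polynomial.aeval v⁻¹ p * v ^ p.natDegree := by
    let _ : Invertible (v⁻¹ : Qv) := invertibleOfNonzero (inv_ne_zero hv)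
    have h1 := Polynomial.eval₂_reverse_mul_pow (algebraMap ℤ Qv) v⁻¹ p
    rw [invOf_eq_inv, inv_inv] at h1
    rw [Polynomial.aeval_def, Polynomial.aeval_def, ← h1, mul_assoc, ← mul_pow,
      inv_mul_cancel₀ hv, one_pow, mul_one]
  have h2 : p.reverse = Polynomial.X ^ (p.natDegree + 2) * p := by
    apply aeval_v_injective
    rw [hrev, map_mul, map_pow, Polynomial.aeval_X]
    have h3 : Polynomial.aeval v⁻¹ p = v * (v * Polynomial.aeval v p) := by
      rw [← h, ← mul_assoc, mul_inv_cancel₀ hv, one_mul]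
    rw [h3]
    ring
  have h3 : p = 0 := by
    by_contra hp
    have h4 := Polynomial.reverse_natDegree_le p
    rw [h2, Polynomial.natDegree_mul (pow_ne_zero _ Polynomial.X_ne_zero) hp,
      Polynomial.natDegree_X_pow] at h4
    omega
  simp [h3]

/-! ### Triangularity of the bar involution and uniqueness -/

theorem bar_smul {n : ℕ} (c : Qv) (h : Hecke n) : bar n (c • h) = barQv c • bar n h := by
  rw [← cst_mul, map_mul, bar_cst, cst_mul]

/-- The bar image of `T_y` is a product of factors `T_a - (v - v⁻¹)`, so `coeffs_prod_mul` applies.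
-/
theorem coeffs_bar_Tw {n : ℕ} {y w : Equiv.Perm (Fin n)} (h : len y ≤ len w) :
    coeffs n (bar n (Tw y)) w = if w = y then 1 else 0 := by
  obtain ⟨h1, h2⟩ := (exists_reduced y).choose_spec
  have h3 := coeffs_prod_mul ((reducedWord y).map fun a ↦ (a, v - v⁻¹)) 1 1
    (fun w _ ↦ by rw [coeffs_one, Pi.single_apply]) w
    (by rw [List.length_map, len_one]; rw [reducedWord, h1]; omega)
  have h4 : (((reducedWord y).map fun a ↦ (a, v - v⁻¹)).map Prod.fst) = reducedWord y := by
    simp [Function.comp_def]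
  rw [h4, mul_one, mul_one, reducedWord, h2, ← reducedWord] at h3
  rw [← h3, Tw, map_list_prod, List.map_map, List.map_map]
  refine congrArg (fun l ↦ coeffs n (List.prod l) w) ?_
  refine List.map_congr_left fun a _ ↦ ?_
  simp only [Function.comp_apply, bar_T, Tinv, map_sub]
  abel

theorem bar_expansion {n : ℕ} (h : Hecke n) (w : Equiv.Perm (Fin n)) :
    coeffs n (bar n h) w = ∑ y, barQv (coeffs n h y) * coeffs n (bar n (Tw y)) w := by
  conv_lhs => rw [Tw_expansion h]
  simp only [map_sum, bar_smul, map_smul, Finset.sum_apply, Pi.smul_apply, smul_eq_mul]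

theorem coeffs_bar_of_max {n : ℕ} {h : Hecke n} {w : Equiv.Perm (Fin n)}
    (hw : ∀ y, coeffs n h y ≠ 0 → len y ≤ len w) :
    coeffs n (bar n h) w = barQv (coeffs n h w) := by
  rw [bar_expansion, Finset.sum_eq_single w]
  · rw [coeffs_bar_Tw le_rfl, if_pos rfl, mul_one]
  · intro y _ hy
    by_cases h0 : coeffs n h y = 0
    · rw [h0, map_zero, zero_mul]
    · rw [coeffs_bar_Tw (hw y h0), if_neg hy.symm, mul_zero]
  · intro h; exact absurd (Finset.mem_univ _) h

-- At an element of maximal length in the support, the bar involution only conjugates the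
-- coefficient, which `InVZv.eq_zero` then kills.
open Classical in
theorem eq_zero_of_bar_eq {n : ℕ} {h : Hecke n} (hb : bar n h = h)
    (hc : ∀ w, InVZv (coeffs n h w)) : h = 0 := by
  apply coeffs_injective n
  rw [map_zero]
  by_contra hne
  obtain ⟨w0, hw0⟩ := Function.ne_iff.mp hne
  obtain ⟨w, hw, hmax⟩ := Finset.exists_max_image
    (Finset.univ.filter fun w ↦ coeffs n h w ≠ 0) len ⟨w0, by simpa using hw0⟩
  have h1 := coeffs_bar_of_max (h := h) (w := w) fun y hy ↦ hmax y (by simpa using hy)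
  rw [hb] at h1
  exact (Finset.mem_filter.mp hw).2 ((hc w).eq_zero h1.symm)

theorem coeffs_sum_smul_Tw {n : ℕ} (c : Equiv.Perm (Fin n) → Qv) :
    coeffs n (∑ y, c y • Tw y) = c := by
  simp only [map_sum, map_smul, coeffs_Tw]
  ext w
  simp [Finset.sum_apply, Pi.single_apply]

theorem isKL_iff {n : ℕ} {w : Equiv.Perm (Fin n)} {x : Hecke n} :
    IsKL w x ↔ bar n x = x ∧ ∀ y, InVZv (coeffs n (x - Tw w) y) := by
  refine and_congr_right fun _ ↦ ⟨?_, fun h ↦ ⟨_, h, Tw_expansion _⟩⟩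
  rintro ⟨c, hc, h⟩ y
  rw [h, coeffs_sum_smul_Tw]
  exact hc y

theorem IsKL.unique {n : ℕ} {w : Equiv.Perm (Fin n)} {x y : Hecke n} (hx : IsKL w x)
    (hy : IsKL w y) : x = y := by
  rw [isKL_iff] at hx hy
  rw [← sub_eq_zero]
  refine eq_zero_of_bar_eq (by rw [map_sub, hx.1, hy.1]) fun z ↦ ?_
  have h := (hx.2 z).sub (hy.2 z)
  rwa [← Pi.sub_apply, ← map_sub, sub_sub_sub_cancel_right] at h

theorem IsKL.C_eq {n : ℕ} {w : Equiv.Perm (Fin n)} {x : Hecke n} (hx : IsKL w x) : C w = x :=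
  IsKL.unique (Classical.epsilon_spec ⟨x, hx⟩) hx

/-! ### The Kazhdan–Lusztig element of a longest element -/

open Classical in
/-- The sum of the `(-v)^{ℓ(w) - ℓ(u)} T_u` over `u ∈ W_J`. -/
def parabolicSum {n : ℕ} (J : Set (Idx n)) (w : Equiv.Perm (Fin n)) : Hecke n :=
  ∑ u, (if u ∈ parabolic J then (-v) ^ (len w - len u) else 0) • Tw u

open Classical in
theorem coeffs_parabolicSum {n : ℕ} (J : Set (Idx n)) (w u : Equiv.Perm (Fin n)) :
    coeffs n (parabolicSum J w) u = if u ∈ parabolic J then (-v) ^ (len w - len u) else 0 := by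
  rw [parabolicSum, coeffs_sum_smul_Tw]

theorem simple_mul_mem_iff {n : ℕ} {J : Set (Idx n)} {a : Idx n} (ha : a ∈ J)
    {w : Equiv.Perm (Fin n)} : simple a * w ∈ parabolic J ↔ w ∈ parabolic J :=
  Subgroup.mul_mem_cancel_left _ (simple_mem_parabolic ha)

/-- The coefficients at `u` and `s_a u` differ by a factor `-v`, which is the eigenvector condition
on the plane of `T_u` and `T_{s_a u}`. -/
theorem T_mul_parabolicSum {n : ℕ} {J : Set (Idx n)} {w : Equiv.Perm (Fin n)}
    (hw : IsLongest (parabolic J) w) {a : Idx n} (ha : a ∈ J) :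
    T a * parabolicSum J w = (-v⁻¹) • parabolicSum J w := by
  apply coeffs_injective n
  ext u
  have hv := v_ne_zero
  rw [coeffs_T_mul, map_smul, Pi.smul_apply, smul_eq_mul, coeffs_parabolicSum, coeffs_parabolicSum,
    simple_mul_mem_iff ha]
  by_cases hu : u ∈ parabolic J
  · simp only [hu, if_true]
    have hl1 := hw.2 u hu
    have hl2 := hw.2 _ ((simple_mul_mem_iff ha).mpr hu)
    rcases inv_lo_lt_or a u⁻¹ with h | h
    · have h1 := len_simple_mul_of_lt h
      rw [if_neg h.not_gt, add_zero, show len w - len u = len w - len (simple a * u) + 1 by omega,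
        pow_succ]
      field_simp
    · have h1 := len_simple_mul_of_gt h
      rw [if_pos h, show len w - len (simple a * u) = len w - len u + 1 by omega, pow_succ]
      ring
  · simp [hu]

/-- An element on which `T_a` acts by `-v⁻¹` for all `a ∈ J` is determined on `W_J` by one
coefficient. -/
theorem coeffs_of_eigen {n : ℕ} {J : Set (Idx n)} {x : Hecke n}
    (hx : ∀ a ∈ J, T a * x = (-v⁻¹) • x) {w : Equiv.Perm (Fin n)}
    (hw : IsLongest (parabolic J) w) {u : Equiv.Perm (Fin n)} (hu : u ∈ parabolic J) :
    coeffs n x u = (-v) ^ (len w - len u) * coeffs n x w := by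
  have hv := v_ne_zero
  -- The eigenvalue equation at `u` relates the coefficients at `u` and `s_a u`, which makes this
  -- product constant on `W_J`.
  have key : ∀ u ∈ parabolic J, coeffs n x u * (-v) ^ len u = coeffs n x 1 := by
    intro u hu
    refine parabolic_induction (p := fun u ↦ coeffs n x u * (-v) ^ len u = coeffs n x 1)
      ?_ ?_ hu
    · simp [len_one]
    · intro a ha u _ ih
      have h1 := congrArg (fun y ↦ coeffs n y u) (hx a ha)
      simp only [coeffs_T_mul, map_smul, Pi.smul_apply, smul_eq_mul] at h1
      rw [← ih]
      rcases inv_lo_lt_or a u⁻¹ with h | h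
      · rw [if_neg h.not_gt, add_zero] at h1
        rw [len_simple_mul_of_lt h, pow_succ, h1]
        field_simp
      · rw [if_pos h] at h1
        have h2 : coeffs n x (simple a * u) = -v * coeffs n x u := by linear_combination h1
        rw [← len_simple_mul_of_gt h, pow_succ, h2]
        ring
  have h1 := key u hu
  have h2 := key w hw.1
  have h3 : len w = (len w - len u) + len u := (Nat.sub_add_cancel (hw.2 u hu)).symm
  have h4 : (-v) ^ len w = (-v) ^ (len w - len u) * (-v) ^ len u := by rw [← pow_add, ← h3]
  have h5 : (-v) ^ len u ≠ 0 := pow_ne_zero _ (neg_ne_zero.mpr hv)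
  apply mul_right_cancel₀ h5
  rw [h1, ← h2, h4]
  ring

theorem coeffs_bar_Tw_of_notMem {n : ℕ} {J : Set (Idx n)} {u : Equiv.Perm (Fin n)}
    (hu : u ∈ parabolic J) : ∀ w ∉ parabolic J, coeffs n (bar n (Tw u)) w = 0 := by
  refine parabolic_induction
    (p := fun u ↦ ∀ w ∉ parabolic J, coeffs n (bar n (Tw u)) w = 0) ?_ ?_ hu
  · intro w hw
    have : w ≠ 1 := by rintro rfl; exact hw (one_mem _)
    rw [Tw_one, map_one, coeffs_one, Pi.single_eq_of_ne this]
  · intro a ha u _ ih w hw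
    have h1 : coeffs n (bar n (T a * Tw u)) w = 0 := by
      have hw' : simple a * w ∉ parabolic J := by rwa [simple_mul_mem_iff ha]
      rw [map_mul, bar_T, Tinv, add_mul, sub_mul, map_add, map_sub, Pi.add_apply, Pi.sub_apply,
        coeffs_T_mul, coeffs_cst_mul, coeffs_cst_mul, ih w hw, ih _ hw']
      simp
    rcases inv_lo_lt_or a u⁻¹ with h | h
    · rwa [T_mul_Tw_of_lt h] at h1
    · rw [T_mul_Tw_of_gt h, map_add, bar_smul, map_add, map_smul, Pi.add_apply, Pi.smul_apply,
        ih w hw, smul_zero, add_zero] at h1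
      exact h1

/-- `T_a + v⁻¹` is bar invariant, so the bar image is again an eigenvector supported on `W_J`. Its
coefficient at `w` is `1`, and `coeffs_of_eigen` determines the rest. -/
theorem bar_parabolicSum {n : ℕ} {J : Set (Idx n)} {w : Equiv.Perm (Fin n)}
    (hw : IsLongest (parabolic J) w) : bar n (parabolicSum J w) = parabolicSum J w := by
  have heig : ∀ a ∈ J, T a * bar n (parabolicSum J w) = (-v⁻¹) • bar n (parabolicSum J w) := by
    intro a ha
    have h := congrArg (bar n) (T_mul_parabolicSum hw ha)
    rw [map_mul, bar_T, bar_smul, map_neg, barQv_v_inv, Tinv, add_mul, sub_mul, cst_mul,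
      cst_mul] at h
    rw [neg_smul] at h ⊢
    rw [eq_neg_iff_add_eq_zero] at h ⊢
    rw [← h]
    abel
  have htop : coeffs n (bar n (parabolicSum J w)) w = 1 := by
    rw [coeffs_bar_of_max, coeffs_parabolicSum, if_pos hw.1, Nat.sub_self, pow_zero, map_one]
    intro y hy
    rw [coeffs_parabolicSum] at hy
    exact hw.2 y (by by_contra h; exact hy (if_neg h))
  apply coeffs_injective n
  ext u
  rw [coeffs_parabolicSum]
  split_ifs with hu
  · rw [coeffs_of_eigen heig hw hu, htop, mul_one]
  · rw [bar_expansion]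
    refine Finset.sum_eq_zero fun y _ ↦ ?_
    rw [coeffs_parabolicSum]
    split_ifs with hy
    · rw [coeffs_bar_Tw_of_notMem hy u hu, mul_zero]
    · rw [map_zero, zero_mul]

theorem isKL_parabolicSum {n k : ℕ} (hk : k ≤ n) {w : Equiv.Perm (Fin n)}
    (hw : IsLongest (parabolic (maxJ n k)) w) : IsKL w (parabolicSum (maxJ n k) w) := by
  rw [isKL_iff]
  refine ⟨bar_parabolicSum hw, fun y ↦ ?_⟩
  rw [map_sub, Pi.sub_apply, coeffs_parabolicSum, coeffs_Tw, Pi.single_apply]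
  by_cases hy : y = w
  · subst hy
    rw [if_pos hw.1, if_pos rfl, Nat.sub_self, pow_zero, sub_self]
    exact InVZv.zero
  · rw [if_neg hy, sub_zero]
    split_ifs with hp
    · have := hw.len_lt hk hp hy
      exact inVZv_neg_pow (by omega)
    · exact InVZv.zero

/-! ### The Yang–Baxter relation -/

/-- The value `v^r / [r]`. -/
def yb (r : ℕ) : Qv := v ^ r / qInt r

/-- The factor `T_a - v^r / [r]`. -/
def Y (n a r : ℕ) : Hecke n := Tn n a - cst n (yb r)

/-- The element `T_a + v⁻¹`. -/
def Z (n a : ℕ) : Hecke n := Tn n a + cst n v⁻¹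

theorem v_pow_ne_one {m : ℕ} (hm : m ≠ 0) : v ^ m ≠ 1 := by
  intro h
  have h1 : (Polynomial.X ^ m : Polynomial ℚ) = 1 := by
    apply IsFractionRing.injective (Polynomial ℚ) Qv
    rw [map_pow, map_one, RatFunc.algebraMap_X]
    exact h
  have h2 := congrArg Polynomial.natDegree h1
  rw [Polynomial.natDegree_X_pow, Polynomial.natDegree_one] at h2
  exact hm h2

theorem v_pow_sub_ne_zero {r : ℕ} (hr : r ≠ 0) : v ^ r - v⁻¹ ^ r ≠ 0 := by
  intro h
  have hv := pow_ne_zero r v_ne_zero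
  apply v_pow_ne_one (m := r + r) (by omega)
  rw [sub_eq_zero, inv_pow] at h
  rw [pow_add]
  nth_rewrite 1 [h]
  exact inv_mul_cancel₀ hv

theorem v_sub_ne_zero : v - v⁻¹ ≠ 0 := by simpa using v_pow_sub_ne_zero one_ne_zero

theorem yb_eq (r : ℕ) : yb r = v ^ r * (v - v⁻¹) / (v ^ r - v⁻¹ ^ r) := by
  rw [yb, qInt, div_div_eq_mul_div]

theorem yb_one : yb 1 = v := by
  rw [yb_eq, pow_one, pow_one, mul_div_cancel_right₀ _ v_sub_ne_zero]

/-- The scalar identity behind Yang–Baxter; it rests on `v - yb (r + 1) = (v^r - v^{-r}) / (v^{r+1}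
- v^{-(r+1)})`. -/
theorem yb_succ {r : ℕ} (hr : r ≠ 0) : yb r * (v - yb (r + 1)) = v⁻¹ * yb (r + 1) := by
  have h1 := v_pow_sub_ne_zero hr
  have h2 := v_pow_sub_ne_zero (Nat.succ_ne_zero r)
  have hv := v_ne_zero
  have hvv : v * v⁻¹ = 1 := mul_inv_cancel₀ hv
  have hr' : v ^ r * v⁻¹ ^ r = 1 := by rw [← mul_pow, hvv, one_pow]
  rw [yb_eq, yb_eq]
  rw [Nat.succ_eq_add_one, pow_succ, pow_succ] at h2
  rw [pow_succ, pow_succ]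
  generalize v ^ r = A at *
  generalize v⁻¹ ^ r = B at *
  generalize v⁻¹ = w at *
  have h3 : v - A * v * (v - w) / (A * v - B * w) = (A - B) / (A * v - B * w) := by
    rw [eq_div_iff h2, sub_mul, div_mul_cancel₀ _ h2]
    linear_combination (A - B) * hvv
  rw [h3, div_mul_div_cancel₀ h1, mul_div_assoc']
  congr 1
  linear_combination (-(A * (v - w))) * hvv

theorem yang_baxter_of_braid {K A : Type*} [Field K] [Ring A] [Algebra K A] {x y : A}
    {q c α β : K} (hx : x * x = q • x + 1) (hy : y * y = q • y + 1)
    (hxy : x * y * x = y * x * y) (h : β * α = α * (q + c) - c * β) :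
    (x + algebraMap K A c) * (y - algebraMap K A α) * (x - algebraMap K A β) =
      (y - algebraMap K A β) * (x - algebraMap K A α) * (y + algebraMap K A c) := by
  simp only [Algebra.algebraMap_eq_smul_one, sub_mul, mul_sub, add_mul, mul_add,
    smul_mul_assoc, mul_smul_comm, one_mul, mul_one, hx, hy, hxy, smul_add, smul_sub,
    smul_smul]
  linear_combination (norm := module) h • (x - y)

theorem add_mul_sub_of_quad {K A : Type*} [Field K] [Ring A] [Algebra K A] {x : A}
    {c d : K} (hx : x * x = (c - d) • x + 1) (h : d * c = 1) :
    (x + algebraMap K A d) * (x - algebraMap K A c) = 0 := by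
  have h' : c * d = 1 := by rw [mul_comm, h]
  simp only [Algebra.algebraMap_eq_smul_one, mul_sub, add_mul, smul_mul_assoc, mul_smul_comm,
    one_mul, mul_one, hx, smul_smul, smul_add, h']
  module

/-- The Yang–Baxter relation with parameters `-1`, `r`, `r + 1`: formally `v^{-1} / [-1] = -v⁻¹`, so
`Z` is the factor of parameter `-1`. -/
theorem yang_baxter {n a b r : ℕ} (ha : 1 ≤ a ∧ a < n) (hb : 1 ≤ b ∧ b < n)
    (h : a + 1 = b ∨ b + 1 = a) (hr : r ≠ 0) :
    Z n a * Y n b r * Y n a (r + 1) = Y n b (r + 1) * Y n a r * Z n b := by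
  have hbraid : Tn n a * Tn n b * Tn n a = Tn n b * Tn n a * Tn n b := by
    rcases h with rfl | rfl
    · exact Tn_braid ha.1 hb.2
    · exact (Tn_braid hb.1 ha.2).symm
  have hqa := Tn_mul_self ha.1 ha.2
  have hqb := Tn_mul_self hb.1 hb.2
  exact yang_baxter_of_braid hqa hqb hbraid (by linear_combination -yb_succ hr)

theorem Z_mul_Y_one {n a : ℕ} (ha : 1 ≤ a ∧ a < n) : Z n a * Y n a 1 = 0 := by
  rw [Z, Y, yb_one]
  exact add_mul_sub_of_quad (Tn_mul_self ha.1 ha.2) (inv_mul_cancel₀ v_ne_zero)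

theorem Tn_commute {n a b : ℕ} (h : a + 1 < b ∨ b + 1 < a) : Commute (Tn n a) (Tn n b) :=
  h.elim (fun h ↦ Tn_comm h) (fun h ↦ (Tn_comm h).symm)

theorem Z_commute_Y {n a b r : ℕ} (h : a + 1 < b ∨ b + 1 < a) : Commute (Z n a) (Y n b r) :=
  ((Tn_commute h).add_left (Algebra.commute_algebraMap_left _ _)).sub_right
    (Algebra.commute_algebraMap_right _ _)

theorem Y_commute_Y {n a b r s : ℕ} (h : a + 1 < b ∨ b + 1 < a) : Commute (Y n a r) (Y n b s) :=
  ((Tn_commute h).sub_left (Algebra.commute_algebraMap_left _ _)).sub_right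
    (Algebra.commute_algebraMap_right _ _)

/-! ### Moving `T_a + v⁻¹` through the rows of the rectangle -/

/-- The product of the factors of the first `m` boxes of row `i` of the rectangle, from right to
left. -/
def rowProd (n k i : ℕ) : ℕ → Hecke n
  | 0 => 1
  | m + 1 => Y n (k + m - i) (n - 1 - i - m) * rowProd n k i m

/-- The product of the rows `t - 1, …, 0` of the rectangle. -/
def rowsProd (n k : ℕ) : ℕ → Hecke n
  | 0 => 1
  | t + 1 => rowProd n k t (n - k) * rowsProd n k t

theorem Z_commute_rowProd {n k i m a : ℕ} (hi : i < k) (h : a + i + 1 < k ∨ k + m < a + i) :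
    Commute (Z n a) (rowProd n k i m) := by
  induction m with
  | zero => exact Commute.one_right _
  | succ m ih => exact (Z_commute_Y (by omega)).mul_right (ih (by omega))

theorem Y_commute_rowProd {n k i m a r : ℕ} (hi : i < k) (h : a + i + 1 < k ∨ k + m < a + i) :
    Commute (Y n a r) (rowProd n k i m) := by
  induction m with
  | zero => exact Commute.one_right _
  | succ m ih => exact (Y_commute_Y (by omega)).mul_right (ih (by omega))

/-- Moving `T_a + v⁻¹` through a row. -/
theorem Z_mul_rowProd {n k i m a : ℕ} (hi : i < k) (hk : k < n) (hm : m ≤ n - k)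
    (ha1 : k ≤ a + i) (ha2 : a + i + 1 < k + m) :
    ∃ U, Z n a * rowProd n k i m = U * Z n (a + 1) := by
  induction m with
  | zero => omega
  | succ m ih =>
    by_cases h : a + i + 1 < k + m
    · obtain ⟨U, hU⟩ := ih (by omega) h
      refine ⟨Y n (k + m - i) (n - 1 - i - m) * U, ?_⟩
      rw [rowProd, ← mul_assoc, (Z_commute_Y (by omega)).eq, mul_assoc, hU, mul_assoc]
    -- The two leftmost factors now have indices `a + 1` and `a`, so Yang–Baxter turns `Z n a` into
    -- `Z n (a + 1)`, which commutes with the remaining factors, of index below `a`.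
    · obtain ⟨j, rfl⟩ : ∃ j, m = j + 1 := ⟨m - 1, by omega⟩
      obtain ⟨r, hr⟩ : ∃ r, n - 1 - i - (j + 1) = r := ⟨_, rfl⟩
      have h1 : k + (j + 1) - i = a + 1 := by omega
      have h2 : k + j - i = a := by omega
      have h3 : n - 1 - i - j = r + 1 := by omega
      refine ⟨Y n (a + 1) (r + 1) * Y n a r * rowProd n k i j, ?_⟩
      rw [rowProd, rowProd, h1, h2, h3, hr, ← mul_assoc, ← mul_assoc,
        yang_baxter (by omega) (by omega) (Or.inl rfl) (by omega), mul_assoc,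
        (Z_commute_rowProd hi (by omega)).eq, ← mul_assoc]

/-- Moving `T_a + v⁻¹` through two consecutive rows. -/
theorem Z_mul_rowProd_mul_rowProd {n k i m : ℕ} (hi : i + 1 < k) (hk : k < n) (hm : m ≤ n - k) :
    ∃ U, Z n (k + m - 1 - i) * (rowProd n k (i + 1) m * rowProd n k i m) =
      U * Z n (k - 1 - i) := by
  induction m with
  | zero => exact ⟨1, by simp [rowProd]⟩
  | succ m ih =>
    obtain ⟨U, hU⟩ := ih (by omega)
    obtain ⟨r, hr⟩ : ∃ r, n - 1 - (i + 1) - m = r := ⟨_, rfl⟩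
    obtain ⟨b, hb⟩ : ∃ b, k + m - 1 - i = b := ⟨_, rfl⟩
    have h1 : k + (m + 1) - 1 - i = b + 1 := by omega
    have h2 : k + m - (i + 1) = b := by omega
    have h3 : k + m - i = b + 1 := by omega
    have h4 : n - 1 - i - m = r + 1 := by omega
    rw [hb] at hU
    refine ⟨Y n b (r + 1) * Y n (b + 1) r * U, ?_⟩
    -- The leftmost factor of row `i` is brought next to that of row `i + 1`. Yang–Baxter then
    -- lowers the index `b + 1` by one per column.
    have hc : Commute (Y n (b + 1) (r + 1)) (rowProd n k (i + 1) m) :=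
      Y_commute_rowProd hi (by omega)
    have hyb := yang_baxter (n := n) (a := b + 1) (b := b) (r := r) (by omega) (by omega)
      (Or.inr rfl) (by omega)
    calc Z n (k + (m + 1) - 1 - i) * (rowProd n k (i + 1) (m + 1) * rowProd n k i (m + 1))
        = Z n (b + 1) * Y n b r * (rowProd n k (i + 1) m * Y n (b + 1) (r + 1)) *
            rowProd n k i m := by
          rw [rowProd, rowProd, h1, h2, h3, h4, hr]
          simp only [mul_assoc]
      _ = Z n (b + 1) * Y n b r * Y n (b + 1) (r + 1) *
            (rowProd n k (i + 1) m * rowProd n k i m) := by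
          rw [← hc.eq]
          simp only [mul_assoc]
      _ = Y n b (r + 1) * Y n (b + 1) r *
            (Z n b * (rowProd n k (i + 1) m * rowProd n k i m)) := by
          rw [hyb]
          simp only [mul_assoc]
      _ = _ := by
          rw [hU]
          simp only [mul_assoc]

/-- Each row raises the index by one, so `a + t` is preserved and `x` is reached with an index above
`k`. -/
theorem Z_mul_rowsProd_middle {n k : ℕ} (hk : k < n) {x : Hecke n}
    (hx : ∀ a, 1 ≤ a → a < n → a ≠ k → Z n a * x = 0) {t : ℕ} (ht : t ≤ k) {a : ℕ}
    (ha1 : k + 1 ≤ a + t) (ha2 : a + t < n) : Z n a * (rowsProd n k t * x) = 0 := by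
  induction t generalizing a with
  | zero => rw [rowsProd, one_mul]; exact hx a (by omega) (by omega) (by omega)
  | succ t ih =>
    obtain ⟨U, hU⟩ := Z_mul_rowProd (n := n) (k := k) (i := t) (m := n - k) (a := a) (by omega) hk
      le_rfl (by omega) (by omega)
    rw [rowsProd, mul_assoc, ← mul_assoc, hU, mul_assoc, ih (by omega) (by omega) (by omega),
      mul_zero]

/-- All indices in these rows exceed `a + 1`, so `Z n a` commutes through to `x`. -/
theorem Z_mul_rowsProd_low {n k : ℕ} (hk : k < n) {x : Hecke n}
    (hx : ∀ a, 1 ≤ a → a < n → a ≠ k → Z n a * x = 0) {t : ℕ} {a : ℕ}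
    (ha1 : 1 ≤ a) (ha2 : a + t < k) : Z n a * (rowsProd n k t * x) = 0 := by
  induction t with
  | zero => rw [rowsProd, one_mul]; exact hx a (by omega) (by omega) (by omega)
  | succ t ih =>
    rw [rowsProd, mul_assoc, ← mul_assoc, (Z_commute_rowProd (by omega) (by omega)).eq, mul_assoc,
      ih (by omega), mul_zero]

/-- `Z n a` commutes with rows until its index is one more than the largest in the next row. Two
rows together then lower it to `k - 1 - i` with `i` rows left, which is the low case. -/
theorem Z_mul_rowsProd_high {n k : ℕ} (hk : k < n) {x : Hecke n}
    (hx : ∀ a, 1 ≤ a → a < n → a ≠ k → Z n a * x = 0) {t : ℕ} (ht : t ≤ k) {a : ℕ}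
    (ha1 : n < a + t) (ha2 : a < n) : Z n a * (rowsProd n k t * x) = 0 := by
  induction t with
  | zero => omega
  | succ t ih =>
    by_cases h : n < a + t
    · rw [rowsProd, mul_assoc, ← mul_assoc, (Z_commute_rowProd (by omega) (by omega)).eq,
        mul_assoc, ih (by omega) h, mul_zero]
    · obtain ⟨i, rfl⟩ : ∃ i, t = i + 1 := ⟨t - 1, by omega⟩
      obtain ⟨U, hU⟩ := Z_mul_rowProd_mul_rowProd (n := n) (k := k) (i := i) (m := n - k)
        (by omega) hk le_rfl
      rw [show k + (n - k) - 1 - i = a by omega] at hU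
      rw [rowsProd, rowsProd, ← mul_assoc (rowProd n k (i + 1) (n - k)), mul_assoc _ _ x,
        ← mul_assoc, hU, mul_assoc, Z_mul_rowsProd_low hk hx (by omega) (by omega), mul_zero]

theorem Z_mul_rowsProd {n k : ℕ} (hk : k < n) {x : Hecke n}
    (hx : ∀ a, 1 ≤ a → a < n → a ≠ k → Z n a * x = 0) {a : ℕ} (ha1 : 1 ≤ a) (ha2 : a < n) :
    Z n a * (rowsProd n k k * x) = 0 := by
  rcases lt_trichotomy (a + k) n with h | h | h
  · exact Z_mul_rowsProd_middle hk hx le_rfl (by omega) h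
  -- For `a = n - k` the leftmost factor belongs to the corner box: it has index `a` and shift `1`.
  · obtain ⟨t, rfl⟩ : ∃ t, k = t + 1 := ⟨k - 1, by omega⟩
    obtain ⟨m, hm⟩ : ∃ m, n - (t + 1) = m + 1 := ⟨n - (t + 1) - 1, by omega⟩
    rw [rowsProd, hm, rowProd, show t + 1 + m - t = a by omega, show n - 1 - t - m = 1 by omega,
      ← mul_assoc, ← mul_assoc, ← mul_assoc, Z_mul_Y_one ⟨ha1, ha2⟩]
    simp only [zero_mul]
  · exact Z_mul_rowsProd_high hk hx le_rfl h ha2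

/-! ### The boxes of a rectangle -/

theorem rowLen_rect {k m i : ℕ} (hi : i < k) : (rect k m).rowLen i = m :=
  eq_of_forall_lt_iff fun j ↦ by
    rw [← YoungDiagram.mem_iff_lt_rowLen, mem_rect]
    exact and_iff_right hi

theorem colLen_rect {k m : ℕ} (hm : 0 < m) : (rect k m).colLen 0 = k :=
  eq_of_forall_lt_iff fun j ↦ by
    rw [← YoungDiagram.mem_iff_lt_colLen, mem_rect]
    exact and_iff_left hm

theorem length_boxes_rect {k m : ℕ} (hm : 0 < m) : (boxes (rect k m)).length = k * m := by
  rw [boxes, colLen_rect hm]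
  have h : ∀ t ≤ k, ((List.range t).reverse.flatMap fun i ↦
      (List.range ((rect k m).rowLen i)).reverse.map fun j ↦ (i, j)).length = t * m := by
    intro t ht
    induction t with
    | zero => simp
    | succ t ih =>
      rw [List.range_succ, List.reverse_append, List.reverse_singleton, List.singleton_append,
        List.flatMap_cons, List.length_append, ih (by omega), List.length_map,
        List.length_reverse, List.length_range, rowLen_rect (by omega)]
      ring
  exact h k le_rfl

/-- A product over the boxes of a rectangle, in terms of its rows. -/
theorem prod_boxes_rect {A : Type*} [Monoid A] {k m : ℕ} (hm : 0 < m) (G : ℕ × ℕ → A)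
    (r : ℕ → ℕ → A) (p : ℕ → A) (hr0 : ∀ i, r i 0 = 1)
    (hr : ∀ i j, r i (j + 1) = G (i, j) * r i j) (hp0 : p 0 = 1)
    (hp : ∀ t, p (t + 1) = r t m * p t) : ((boxes (rect k m)).map G).prod = p k := by
  have hrow : ∀ i j, (((List.range j).reverse.map fun j ↦ (i, j)).map G).prod = r i j := by
    intro i j
    induction j with
    | zero => simp [hr0]
    | succ j ih => rw [List.range_succ, hr, ← ih]; simp
  rw [boxes, colLen_rect hm]
  have h : ∀ t ≤ k, (((List.range t).reverse.flatMap fun i ↦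
      (List.range ((rect k m).rowLen i)).reverse.map fun j ↦ (i, j)).map G).prod = p t := by
    intro t ht
    induction t with
    | zero => simp [hp0]
    | succ t ih =>
      rw [List.range_succ, List.reverse_append, List.reverse_singleton, List.singleton_append,
        List.flatMap_cons, List.map_append, List.prod_append, ih (by omega), hp,
        rowLen_rect (by omega), hrow]
  exact h k le_rfl

/-- In a rectangle both neighbours inside the diagram have the same shift, which makes the shift the
hook length. -/
theorem shift_rect {k m i j : ℕ} (hi : i < k) (hj : j < m) :
    shift (rect k m) i j = k + m - 1 - i - j := by
  have h0 : ∀ i j, ¬ (i < k ∧ j < m) → shift (rect k m) i j = 0 := by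
    intro i j h
    rw [shift, dif_neg (by rwa [mem_rect])]
  obtain ⟨d, hd⟩ : ∃ d, k + m - 1 - i - j = d := ⟨_, rfl⟩
  induction d generalizing i j with
  | zero => omega
  | succ d ih =>
    rw [shift, dif_pos (mem_rect.mpr ⟨hi, hj⟩)]
    by_cases h1 : j + 1 < m
    · by_cases h2 : i + 1 < k
      · rw [ih hi h1 (by omega), ih h2 hj (by omega)]
        omega
      · rw [ih hi h1 (by omega), h0 (i + 1) j (by omega)]
        omega
    · by_cases h2 : i + 1 < k
      · rw [h0 i (j + 1) (by omega), ih h2 hj (by omega)]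
        omega
      · rw [h0 i (j + 1) (by omega), h0 (i + 1) j (by omega)]
        omega

theorem shift_ne_zero {μ : YoungDiagram} {i j : ℕ} (h : (i, j) ∈ μ) : shift μ i j ≠ 0 := by
  rw [shift, dif_pos h]
  omega

theorem map_attach_boxes {A : Type*} {μ : YoungDiagram} (F : {b // b ∈ boxes μ} → A)
    (G : ℕ × ℕ → A) (h : ∀ b, F b = G b.1) : (boxes μ).attach.map F = (boxes μ).map G := by
  rw [show F = G ∘ Subtype.val from funext h, ← List.map_map, List.attach_map_subtype_val]

theorem X_rect {n k : ℕ} (hk : k < n) : X (le_refl (rect k (n - k))) = rowsProd n k k := by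
  rw [X, map_attach_boxes _ fun b ↦ Y n (k + b.2 - b.1) (n - 1 - b.1 - b.2)]
  · exact prod_boxes_rect (by omega) _ (rowProd n k) (rowsProd n k) (fun _ ↦ rfl)
      (fun _ _ ↦ rfl) rfl (fun _ ↦ rfl)
  · rintro ⟨⟨i, j⟩, hb⟩
    have h := mem_rect.mp (mem_boxes.mp hb)
    rw [shift_rect h.1 h.2, show k + (n - k) - 1 - i - j = n - 1 - i - j by omega, Y, yb,
      ← Tn_val]
    rfl

/-! ### The permutation of a rectangle -/

/-- The simple reflection `s_a`, with value `1` for `a` out of range. -/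
def simpleN (n a : ℕ) : Equiv.Perm (Fin n) := if h : 1 ≤ a ∧ a < n then simple ⟨a, h⟩ else 1

theorem simpleN_val {n : ℕ} (a : Idx n) : simpleN n a.1 = simple a := dif_pos a.2

theorem simpleN_apply {n a : ℕ} (h1 : 1 ≤ a) (h2 : a < n) (x : Fin n) :
    (simpleN n a x).1 = if x.1 + 1 = a then a else if x.1 = a then a - 1 else x.1 := by
  rw [simpleN, dif_pos ⟨h1, h2⟩, simple, Equiv.swap_apply_def]
  simp only [Fin.ext_iff]
  split_ifs <;> first | omega | rfl

/-- The product of the reflections of the first `m` boxes of row `i`, from right to left. -/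
def rowPerm (n k i : ℕ) : ℕ → Equiv.Perm (Fin n)
  | 0 => 1
  | m + 1 => simpleN n (k + m - i) * rowPerm n k i m

/-- The product of the rows `t - 1, …, 0`. -/
def rowsPerm (n k : ℕ) : ℕ → Equiv.Perm (Fin n)
  | 0 => 1
  | t + 1 => rowPerm n k t (n - k) * rowsPerm n k t

/-- A row is a cycle: one letter jumps over `m` others, each of which moves down by one. -/
theorem rowPerm_apply {n k i m : ℕ} (hi : i < k) (hk : k < n) (hm : m ≤ n - k) (x : Fin n) :
    (rowPerm n k i m x).1 = if x.1 + i + 1 = k then x.1 + m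
      else if k ≤ x.1 + i ∧ x.1 + i < k + m then x.1 - 1 else x.1 := by
  induction m with
  | zero => rw [rowPerm, Equiv.Perm.one_apply]; split_ifs <;> omega
  | succ m ih =>
    rw [rowPerm, Equiv.Perm.mul_apply, simpleN_apply (by omega) (by omega), ih (by omega)]
    have := x.2
    split_ifs <;> omega

theorem rowsPerm_apply {n k t : ℕ} (hk : k < n) (ht : t ≤ k) (x : Fin n) :
    (rowsPerm n k t x).1 = if x.1 + t < k then x.1
      else if x.1 < k then x.1 + (n - k) else x.1 - t := by
  induction t with
  | zero => rw [rowsPerm, Equiv.Perm.one_apply]; split_ifs <;> omega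
  | succ t ih =>
    rw [rowsPerm, Equiv.Perm.mul_apply, rowPerm_apply (by omega) hk le_rfl, ih (by omega)]
    have := x.2
    split_ifs <;> omega

theorem wYoung_rect {n k : ℕ} (hk : k < n) :
    wYoung (le_refl (rect k (n - k))) = rowsPerm n k k := by
  rw [wYoung, wordPerm, List.map_map, map_attach_boxes _ fun b ↦ simpleN n (k + b.2 - b.1)]
  · exact prod_boxes_rect (by omega) _ (rowPerm n k) (rowsPerm n k) (fun _ ↦ rfl)
      (fun _ _ ↦ rfl) rfl (fun _ ↦ rfl)
  · intro b
    exact (simpleN_val (boxIdx (le_refl (rect k (n - k))) b)).symm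

theorem wYoung_rect_apply {n k : ℕ} (hk : k < n) (x : Fin n) :
    (wYoung (le_refl (rect k (n - k))) x).1 = if x.1 < k then x.1 + (n - k) else x.1 - k := by
  rw [wYoung_rect hk, rowsPerm_apply hk le_rfl]
  split_ifs <;> omega

theorem wYoung_rect_lt_iff {n k : ℕ} (hk : k < n) {i j : Fin n} (hij : i < j) :
    wYoung (le_refl (rect k (n - k))) j < wYoung (le_refl (rect k (n - k))) i ↔
      i.1 < k ∧ k ≤ j.1 := by
  rw [Fin.lt_def, wYoung_rect_apply hk, wYoung_rect_apply hk]
  rw [Fin.lt_def] at hij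
  have := j.2
  split_ifs <;> omega

/-- The inversions of `w_λ` are exactly the pairs of positions from different blocks. As `u`
preserves the blocks, these remain inversions of `w_λ u`. -/
theorem wYoung_rect_mem_minReps {n k : ℕ} (hk : k < n) :
    wYoung (le_refl (rect k (n - k))) ∈ minReps (maxJ n k) := by
  intro u hu
  rw [len_eq_card, len_eq_card]
  refine Finset.card_le_card ?_
  rintro ⟨i, j⟩ h
  rw [mem_inversions] at h ⊢
  obtain ⟨hij, h⟩ := h
  rw [wYoung_rect_lt_iff hk hij] at h
  have h1 := (parabolic_lt_iff hu i).mpr h.1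
  have h2 := (parabolic_lt_iff hu j).not.mpr h.2.not_gt
  refine ⟨hij, ?_⟩
  rw [Equiv.Perm.mul_apply, Equiv.Perm.mul_apply, wYoung_rect_lt_iff hk (by rw [Fin.lt_def]; omega)]
  omega

theorem le_len_wYoung_rect {n k : ℕ} (hk : k < n) :
    k * (n - k) ≤ len (wYoung (le_refl (rect k (n - k)))) := by
  rw [len_eq_card]
  have h : (Finset.univ : Finset (Fin k × Fin (n - k))).card = k * (n - k) := by
    simp
  rw [← h]
  refine Finset.card_le_card_of_injOn
    (fun p ↦ (⟨p.1.1, by omega⟩, ⟨k + p.2.1, by omega⟩)) ?_ ?_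
  · rintro ⟨i, j⟩ _
    have hij : (⟨i.1, by omega⟩ : Fin n) < ⟨k + j.1, by omega⟩ := by
      rw [Fin.lt_def]; simp only; omega
    rw [Finset.mem_coe, mem_inversions]
    exact ⟨hij, (wYoung_rect_lt_iff hk hij).mpr ⟨i.2, Nat.le_add_right _ _⟩⟩
  · rintro ⟨i, j⟩ _ ⟨i', j'⟩ _ h
    simp only [Prod.mk.injEq, Fin.mk.injEq] at h
    ext <;> simp only <;> omega

theorem IsLongest.parabolic_zero {n : ℕ} {w : Equiv.Perm (Fin n)} (hw : IsLongest ⊤ w) :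
    IsLongest (parabolic (maxJ n 0)) w := by
  rwa [parabolic_maxJ_zero]

theorem wYoung_rect_mul {n k : ℕ} (hk : k < n) {w₀ w₀J : Equiv.Perm (Fin n)}
    (hw₀ : IsLongest ⊤ w₀) (hw₀J : IsLongest (parabolic (maxJ n k)) w₀J) :
    wYoung (le_refl (rect k (n - k))) * w₀J = w₀ := by
  ext x
  rw [Equiv.Perm.mul_apply, wYoung_rect_apply hk, hw₀J.apply_val hk.le,
    hw₀.parabolic_zero.apply_val (Nat.zero_le n)]
  have := x.2
  split_ifs <;> omega

/-! ### The element `X_λ C_J` -/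

/-- `[r]` is bar invariant and `(v^r - v^{-r}) / [r] = v - v⁻¹`. The same correction occurs in the
bar image of `T_a`, so each factor of `X_λ` is bar invariant. -/
theorem barQv_yb {r : ℕ} (hr : r ≠ 0) : barQv (yb r) = yb r - v + v⁻¹ := by
  have h1 := v_pow_sub_ne_zero hr
  have h2 : v⁻¹ ^ r - v ^ r ≠ 0 := by rw [← neg_sub]; exact neg_ne_zero.mpr h1
  rw [yb_eq, map_div₀, map_mul, map_sub, map_sub, map_pow, map_pow, barQv_v, barQv_v_inv]
  generalize v⁻¹ = w at *
  rw [div_eq_iff h2, add_mul, sub_mul, ← neg_sub (v ^ r), mul_neg, div_mul_cancel₀ _ h1]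
  ring

theorem bar_X {n k : ℕ} {μ : YoungDiagram} (hμ : μ ≤ rect k (n - k)) : bar n (X hμ) = X hμ := by
  rw [X, map_list_prod, List.map_map]
  refine congrArg List.prod (List.map_congr_left ?_)
  rintro ⟨⟨i, j⟩, hb⟩ _
  have h := barQv_yb (shift_ne_zero (mem_boxes.mp hb))
  rw [yb] at h
  rw [Function.comp_apply, map_sub, bar_T, bar_cst, h, Tinv]
  simp only [map_add, map_sub]
  abel

theorem coeffs_X_mul_Tw {n k : ℕ} {μ : YoungDiagram} (hμ : μ ≤ rect k (n - k))
    {u w : Equiv.Perm (Fin n)} (h : (boxes μ).length + len u ≤ len w) :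
    coeffs n (X hμ * Tw u) w = if w = wYoung hμ * u then 1 else 0 := by
  have h1 := coeffs_prod_mul ((boxes μ).attach.map fun b ↦
    (boxIdx hμ b, v ^ shift μ b.1.1 b.1.2 / qInt (shift μ b.1.1 b.1.2))) (Tw u) u
    (fun w _ ↦ by rw [coeffs_Tw, Pi.single_apply]) w (by simpa using h)
  rw [List.map_map, List.map_map] at h1
  exact h1

theorem Z_mul_parabolicSum {n k : ℕ} {w : Equiv.Perm (Fin n)}
    (hw : IsLongest (parabolic (maxJ n k)) w) {a : ℕ} (h1 : 1 ≤ a) (h2 : a < n) (h3 : a ≠ k) :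
    Z n a * parabolicSum (maxJ n k) w = 0 := by
  have h := T_mul_parabolicSum hw (a := ⟨a, h1, h2⟩) h3
  rw [← Tn_val] at h
  rw [Z, add_mul, h, cst_mul, neg_smul, neg_add_cancel]

theorem X_rect_mul_parabolicSum {n k : ℕ} (hk : k < n) {w₀ w₀J : Equiv.Perm (Fin n)}
    (hw₀ : IsLongest ⊤ w₀) (hw₀J : IsLongest (parabolic (maxJ n k)) w₀J) :
    X (le_refl (rect k (n - k))) * parabolicSum (maxJ n k) w₀J = parabolicSum (maxJ n 0) w₀ := by
  have heig : ∀ a ∈ maxJ n 0, T a * (X (le_refl (rect k (n - k))) * parabolicSum (maxJ n k) w₀J) =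
      (-v⁻¹) • (X (le_refl (rect k (n - k))) * parabolicSum (maxJ n k) w₀J) := by
    intro a _
    have h := Z_mul_rowsProd hk (fun b h1 h2 h3 ↦ Z_mul_parabolicSum hw₀J h1 h2 h3) a.2.1 a.2.2
    rw [← X_rect hk, Z, add_mul, cst_mul, Tn_val] at h
    rw [neg_smul]
    exact eq_neg_of_add_eq_zero_left h
  have hmul := wYoung_rect_mul hk hw₀ hw₀J
  have hlen := len_mul_of_minReps (wYoung_rect_mem_minReps hk) hw₀J.1
  rw [hmul] at hlen
  -- By length, only leading terms `w_λ u` with `u ∈ W_J` can reach `w₀`, and only `u = w₀J` does.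
  have htop : coeffs n (X (le_refl (rect k (n - k))) * parabolicSum (maxJ n k) w₀J) w₀ = 1 := by
    rw [parabolicSum, Finset.mul_sum, map_sum, Finset.sum_apply, Finset.sum_eq_single w₀J]
    · rw [if_pos hw₀J.1, Nat.sub_self, pow_zero, one_smul, coeffs_X_mul_Tw, if_pos hmul.symm]
      rw [length_boxes_rect (by omega), hlen]
      exact Nat.add_le_add_right (le_len_wYoung_rect hk) _
    · intro u _ hu
      split_ifs with hp
      · rw [mul_smul_comm, map_smul, Pi.smul_apply, coeffs_X_mul_Tw, if_neg, smul_zero]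
        · rw [← hmul, mul_left_cancel_iff]
          exact hu.symm
        · rw [length_boxes_rect (by omega), hlen]
          exact Nat.add_le_add (le_len_wYoung_rect hk) (hw₀J.2 u hp)
      · rw [zero_smul, mul_zero, map_zero, Pi.zero_apply]
    · intro h; exact absurd (Finset.mem_univ _) h
  apply coeffs_injective n
  ext u
  have hu : u ∈ parabolic (maxJ n 0) := by rw [parabolic_maxJ_zero]; trivial
  rw [coeffs_of_eigen heig hw₀.parabolic_zero hu, htop, mul_one, coeffs_parabolicSum, if_pos hu]

/-! ### The induced module -/

theorem smul_smul_m1 {n : ℕ} (J : Set (Idx n)) (c : Qv) (h : Hecke n) :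
    (c • h) • m1 J = c • (h • m1 J) := smul_assoc c h (m1 J)

theorem T_smul_m1 {n : ℕ} {J : Set (Idx n)} {a : Idx n} (ha : a ∈ J) :
    T a • m1 J = (-v⁻¹) • m1 J := by
  have h : (T a + cst n v⁻¹) • m1 J = 0 := by
    rw [m1, ← Submodule.Quotient.mk_smul, smul_eq_mul, mul_one, Submodule.Quotient.mk_eq_zero]
    exact Submodule.subset_span ⟨a, ha, rfl⟩
  rw [add_smul, cst, Algebra.algebraMap_eq_smul_one, smul_smul_m1, one_smul] at h
  rw [neg_smul]
  exact eq_neg_of_add_eq_zero_left h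

theorem Tw_smul_m1 {n : ℕ} {J : Set (Idx n)} {u : Equiv.Perm (Fin n)} (hu : u ∈ parabolic J) :
    Tw u • m1 J = ((-v⁻¹) ^ len u) • m1 J := by
  refine parabolic_induction (p := fun u ↦ Tw u • m1 J = ((-v⁻¹) ^ len u) • m1 J) ?_ ?_ hu
  · rw [Tw_one, one_smul, len_one, pow_zero, one_smul]
  · intro a ha u _ ih
    have h1 : (T a * Tw u) • m1 J = ((-v⁻¹) ^ (len u + 1)) • m1 J := by
      rw [mul_smul, ih, smul_comm, T_smul_m1 ha, smul_smul, pow_succ]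
    rcases inv_lo_lt_or a u⁻¹ with h | h
    · rwa [T_mul_Tw_of_lt h, ← len_simple_mul_of_lt h] at h1
    · rw [T_mul_Tw_of_gt h, add_smul, smul_smul_m1, ih, ← eq_sub_iff_add_eq, smul_smul,
        ← sub_smul] at h1
      rw [h1, ← len_simple_mul_of_gt h]
      congr 1
      have hv := mul_inv_cancel₀ v_ne_zero
      rw [pow_succ, pow_succ]
      linear_combination ((-v⁻¹) ^ len (simple a * u)) * hv

-- Only spanning by the `m_z` is proved here; the coefficients are pinned down by
-- `coeffs_embed_sum`.
open Classical in
theorem exists_expansion {n k : ℕ} (h : Hecke n) :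
    ∃ c : Equiv.Perm (Fin n) → Qv,
      h • m1 (maxJ n k) = ∑ z with z ∈ minReps (maxJ n k), c z • mb (maxJ n k) z := by
  have key : ∀ w : Equiv.Perm (Fin n), ∃ c : Equiv.Perm (Fin n) → Qv,
      Tw w • m1 (maxJ n k) = ∑ z with z ∈ minReps (maxJ n k), c z • mb (maxJ n k) z := by
    intro w
    obtain ⟨z, hz, u, hu, rfl⟩ := exists_minReps_mul (maxJ n k) w
    refine ⟨Pi.single z ((-v⁻¹) ^ len u), ?_⟩
    rw [Finset.sum_eq_single z, Pi.single_eq_same, ← Tw_mul_Tw (len_mul_of_minReps hz hu), mul_smul,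
      Tw_smul_m1 hu, smul_comm, mb]
    · intro y _ hy
      rw [Pi.single_eq_of_ne hy, zero_smul]
    · intro h
      exact absurd (Finset.mem_filter.mpr ⟨Finset.mem_univ _, hz⟩) h
  choose c hc using key
  refine ⟨fun z ↦ ∑ w, coeffs n h w * c w z, ?_⟩
  conv_lhs => rw [Tw_expansion h]
  simp only [Finset.sum_smul, smul_smul_m1, hc, Finset.smul_sum, smul_smul]
  rw [Finset.sum_comm]

theorem indIdeal_le_ker {n : ℕ} {J : Set (Idx n)} {w : Equiv.Perm (Fin n)}
    (hw : IsLongest (parabolic J) w) :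
    indIdeal J ≤ (LinearMap.toSpanSingleton (Hecke n) (Hecke n) (parabolicSum J w)).ker := by
  refine Submodule.span_le.mpr ?_
  rintro _ ⟨a, ha, rfl⟩
  rw [SetLike.mem_coe, LinearMap.mem_ker, LinearMap.toSpanSingleton_apply, smul_eq_mul, add_mul,
    T_mul_parabolicSum hw ha, cst_mul, neg_smul, neg_add_cancel]

/-- The embedding of `M^J` into `H` which maps `m_1` to `C_J`. -/
def embed {n : ℕ} {J : Set (Idx n)} {w : Equiv.Perm (Fin n)} (hw : IsLongest (parabolic J) w) :
    M J →ₗ[Hecke n] Hecke n :=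
  Submodule.liftQ (indIdeal J) _ (indIdeal_le_ker hw)

theorem embed_smul_m1 {n : ℕ} {J : Set (Idx n)} {w : Equiv.Perm (Fin n)}
    (hw : IsLongest (parabolic J) w) (h : Hecke n) :
    embed hw (h • m1 J) = h * parabolicSum J w := by
  rw [map_smul]
  change h • ((1 : Hecke n) • parabolicSum J w) = _
  rw [one_smul, smul_eq_mul]

theorem embed_smul_mb {n : ℕ} {J : Set (Idx n)} {w : Equiv.Perm (Fin n)}
    (hw : IsLongest (parabolic J) w) (c : Qv) (z : Equiv.Perm (Fin n)) :
    embed hw (c • mb J z) = c • (Tw z * parabolicSum J w) := by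
  rw [mb, ← smul_smul_m1, embed_smul_m1, smul_mul_assoc]

theorem embed_barM {n : ℕ} {J : Set (Idx n)} {w : Equiv.Perm (Fin n)}
    (hw : IsLongest (parabolic J) w) (x : M J) : embed hw (barM J x) = bar n (embed hw x) := by
  obtain ⟨h, rfl⟩ : ∃ h : Hecke n, x = h • m1 J := by
    obtain ⟨h, rfl⟩ := Submodule.Quotient.mk_surjective _ x
    exact ⟨h, by rw [m1, ← Submodule.Quotient.mk_smul, smul_eq_mul, mul_one]⟩
  rw [barM_smul_m1, embed_smul_m1, embed_smul_m1, map_mul, bar_parabolicSum hw]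

open Classical in
theorem coeffs_Tw_mul_parabolicSum {n k : ℕ} {w z : Equiv.Perm (Fin n)}
    (hz : z ∈ minReps (maxJ n k)) (y : Equiv.Perm (Fin n)) :
    coeffs n (Tw z * parabolicSum (maxJ n k) w) y =
      if z⁻¹ * y ∈ parabolic (maxJ n k) then (-v) ^ (len w - len (z⁻¹ * y)) else 0 := by
  rw [parabolicSum, Finset.mul_sum, map_sum, Finset.sum_apply, Finset.sum_eq_single (z⁻¹ * y)]
  · split_ifs with h
    · rw [mul_smul_comm, Tw_mul_Tw (len_mul_of_minReps hz h), mul_inv_cancel_left, map_smul,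
        coeffs_Tw, Pi.smul_apply, Pi.single_eq_same, smul_eq_mul, mul_one]
    · rw [zero_smul, mul_zero, map_zero, Pi.zero_apply]
  · intro u _ hu
    split_ifs with h
    · rw [mul_smul_comm, Tw_mul_Tw (len_mul_of_minReps hz h), map_smul,
        coeffs_Tw, Pi.smul_apply, Pi.single_eq_of_ne, smul_zero]
      rintro rfl
      exact hu (inv_mul_cancel_left z u).symm
    · rw [zero_smul, mul_zero, map_zero, Pi.zero_apply]
  · intro h; exact absurd (Finset.mem_univ _) h

theorem coeffs_Tw_mul_parabolicSum_top {n k : ℕ} {w z z' : Equiv.Perm (Fin n)}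
    (hw : IsLongest (parabolic (maxJ n k)) w)
    (hz : z ∈ minReps (maxJ n k)) (hz' : z' ∈ minReps (maxJ n k)) :
    coeffs n (Tw z * parabolicSum (maxJ n k) w) (z' * w) = if z = z' then 1 else 0 := by
  rw [coeffs_Tw_mul_parabolicSum hz]
  split_ifs with h1 h2 h2
  · rw [h2, inv_mul_cancel_left, Nat.sub_self, pow_zero]
  · exact absurd (minReps_eq_of_mul_eq hz hz' h1 hw.1 (mul_inv_cancel_left z _)) h2
  · rw [h2, inv_mul_cancel_left] at h1
    exact absurd hw.1 h1
  · rfl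

-- The images of the `m_y` are supported on disjoint cosets `y W_J`, and `z * w` is the top element
-- of the coset of `z`. This recovers coefficients in `M^J` from those in `H`.
open Classical in
theorem coeffs_embed_sum {n k : ℕ} {w : Equiv.Perm (Fin n)}
    (hw : IsLongest (parabolic (maxJ n k)) w) (c : Equiv.Perm (Fin n) → Qv)
    {z : Equiv.Perm (Fin n)} (hz : z ∈ minReps (maxJ n k)) :
    coeffs n (embed hw (∑ z with z ∈ minReps (maxJ n k), c z • mb (maxJ n k) z)) (z * w) = c z := by
  rw [map_sum, map_sum, Finset.sum_apply, Finset.sum_eq_single z]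
  · rw [embed_smul_mb, map_smul, Pi.smul_apply, coeffs_Tw_mul_parabolicSum_top hw hz hz, if_pos rfl,
      smul_eq_mul, mul_one]
  · intro y hy hyz
    rw [embed_smul_mb, map_smul, Pi.smul_apply,
      coeffs_Tw_mul_parabolicSum_top hw (Finset.mem_filter.mp hy).2 hz, if_neg hyz, smul_zero]
  · intro h
    exact absurd (Finset.mem_filter.mpr ⟨Finset.mem_univ _, hz⟩) h

-- Under `embed` the difference becomes bar invariant with coefficients in `v ℤ[v]`, hence zero in
-- `H`; its coefficients in `M^J` then vanish too.
open Classical in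
theorem IsParabolicKL.unique {n k : ℕ} {w : Equiv.Perm (Fin n)}
    (hw : IsLongest (parabolic (maxJ n k)) w) {y : Equiv.Perm (Fin n)} {x x' : M (maxJ n k)}
    (hx : IsParabolicKL (maxJ n k) y x) (hx' : IsParabolicKL (maxJ n k) y x') : x = x' := by
  obtain ⟨hb, c, hc, hs⟩ := hx
  obtain ⟨hb', c', hc', hs'⟩ := hx'
  have hd : x - x' = ∑ z with z ∈ minReps (maxJ n k), (c z - c' z) • mb (maxJ n k) z := by
    rw [← sub_sub_sub_cancel_right x x' (mb (maxJ n k) y), hs, hs', ← Finset.sum_sub_distrib]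
    exact Finset.sum_congr rfl fun z _ ↦ (sub_smul _ _ _).symm
  have h0 : embed hw (x - x') = 0 := by
    refine eq_zero_of_bar_eq (by rw [← embed_barM, map_sub, hb, hb']) fun u ↦ ?_
    rw [hd, map_sum, map_sum, Finset.sum_apply]
    refine InVZv.sum fun z hz ↦ ?_
    rw [embed_smul_mb, map_smul, Pi.smul_apply, smul_eq_mul,
      coeffs_Tw_mul_parabolicSum (Finset.mem_filter.mp hz).2]
    split_ifs
    · exact ((hc z).sub (hc' z)).mul_neg_pow _
    · rw [mul_zero]; exact InVZv.zero
  rw [← sub_eq_zero, hd]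
  refine Finset.sum_eq_zero fun z hz ↦ ?_
  have h1 := coeffs_embed_sum hw (fun z ↦ c z - c' z) (Finset.mem_filter.mp hz).2
  rw [← hd, h0, map_zero, Pi.zero_apply] at h1
  rw [← h1, zero_smul]

open Classical in
theorem isParabolicKL_X_rect {n k : ℕ} (hk : k < n) {w₀ w₀J : Equiv.Perm (Fin n)}
    (hw₀ : IsLongest ⊤ w₀) (hw₀J : IsLongest (parabolic (maxJ n k)) w₀J) :
    IsParabolicKL (maxJ n k) (wYoung (le_refl (rect k (n - k))))
      (X (le_refl (rect k (n - k))) • m1 (maxJ n k)) := by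
  have hmul := wYoung_rect_mul hk hw₀ hw₀J
  have hmem := wYoung_rect_mem_minReps hk
  refine ⟨by rw [barM_smul_m1, bar_X], ?_⟩
  obtain ⟨c, hc⟩ := exists_expansion (k := k) (X (le_refl (rect k (n - k))))
  -- Under `embed` the element becomes `C_{w_0}`, so `c z` is its coefficient at `z * w₀J`.
  have hcz : ∀ z ∈ minReps (maxJ n k), c z = (-v) ^ (len w₀ - len (z * w₀J)) := by
    intro z hz
    rw [← coeffs_embed_sum hw₀J c hz, ← hc, embed_smul_m1, X_rect_mul_parabolicSum hk hw₀ hw₀J,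
      coeffs_parabolicSum, if_pos (by rw [parabolic_maxJ_zero]; trivial)]
  -- The coefficient at `w_λ` is `1` and is cancelled by subtracting `m_{w_λ}`. Outside `W^J` the
  -- function `c` is arbitrary, so it is replaced by zero there.
  refine ⟨fun z ↦ if z ∈ minReps (maxJ n k) ∧ z ≠ wYoung (le_refl (rect k (n - k))) then c z else 0,
    fun z ↦ ?_, ?_⟩
  · beta_reduce
    split_ifs with h
    · rw [hcz z h.1]
      have hne : z * w₀J ≠ w₀ := by
        rw [← hmul, ne_eq, mul_left_inj]
        exact h.2
      have := hw₀.parabolic_zero.len_lt (Nat.zero_le n) (u := z * w₀J)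
        (by rw [parabolic_maxJ_zero]; trivial) hne
      exact inVZv_neg_pow (by omega)
    · exact InVZv.zero
  · rw [hc, sub_eq_iff_eq_add, ← sub_eq_iff_eq_add', ← Finset.sum_sub_distrib,
      Finset.sum_eq_single (wYoung (le_refl (rect k (n - k))))]
    · beta_reduce
      rw [if_neg (fun h ↦ h.2 rfl), zero_smul, sub_zero, hcz _ hmem, hmul, Nat.sub_self, pow_zero,
        one_smul]
    · intro z hz hne
      beta_reduce
      rw [if_pos ⟨(Finset.mem_filter.mp hz).2, hne⟩, sub_self]
    · intro h
      exact absurd (Finset.mem_filter.mpr ⟨Finset.mem_univ _, hmem⟩) h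

end HeckeGrass

end

theorem proposition2p2 (n k : ℕ) (hk : k < n)
    (w₀ w₀J : Equiv.Perm (Fin n))
    (hw₀ : HeckeGrass.IsLongest ⊤ w₀)
    (hw₀J : HeckeGrass.IsLongest (HeckeGrass.parabolic (HeckeGrass.maxJ n k)) w₀J) :
    -- `w_λ ∈ W^J`, the element `C^J_{w_λ}` exists and is unique, and `X_λ m_1 = C^J_{w_λ}`
    (HeckeGrass.wYoung (le_refl (HeckeGrass.rect k (n - k))) ∈
        HeckeGrass.minReps (HeckeGrass.maxJ n k) ∧
      (∃! x, HeckeGrass.IsParabolicKL (HeckeGrass.maxJ n k)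
        (HeckeGrass.wYoung (le_refl (HeckeGrass.rect k (n - k)))) x) ∧
      HeckeGrass.X (le_refl (HeckeGrass.rect k (n - k))) •
          HeckeGrass.m1 (HeckeGrass.maxJ n k) =
        HeckeGrass.CJ (HeckeGrass.maxJ n k)
          (HeckeGrass.wYoung (le_refl (HeckeGrass.rect k (n - k))))) ∧
    -- `w_λ w_0^J = w_0`, the elements `C_J = C_{w_0^J}` and `C_{w_0}` exist and are unique,
    -- and `X_λ C_J = C_{w_0}`
    (HeckeGrass.wYoung (le_refl (HeckeGrass.rect k (n - k))) * w₀J = w₀ ∧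
      (∃! x, HeckeGrass.IsKL w₀J x) ∧
      (∃! x, HeckeGrass.IsKL w₀ x) ∧
      HeckeGrass.X (le_refl (HeckeGrass.rect k (n - k))) * HeckeGrass.C w₀J =
        HeckeGrass.C w₀) := by
  have hX := HeckeGrass.isParabolicKL_X_rect hk hw₀ hw₀J
  have hJ := HeckeGrass.isKL_parabolicSum hk.le hw₀J
  have h0 := HeckeGrass.isKL_parabolicSum (Nat.zero_le n) hw₀.parabolic_zero
  refine ⟨⟨HeckeGrass.wYoung_rect_mem_minReps hk, ⟨_, hX, fun y hy ↦ hy.unique hw₀J hX⟩,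
    hX.unique hw₀J (Classical.epsilon_spec ⟨_, hX⟩)⟩,
    HeckeGrass.wYoung_rect_mul hk hw₀ hw₀J, ⟨_, hJ, fun y hy ↦ hy.unique hJ⟩,
    ⟨_, h0, fun y hy ↦ hy.unique h0⟩, ?_⟩
  rw [hJ.C_eq, h0.C_eq]
  exact HeckeGrass.X_rect_mul_parabolicSum hk hw₀ hw₀J
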